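/- Let $k$ be a field and $G$ an abelian group. A quantum variable is a variable $x$ together with an element $g_x\in G$ and a character $\chi^x:G\to k^*$. In a Hopf algebra $H$ over $k$ with a fixed Hopf algebra homomorphism $\varphi:k[G]\to H$, the admissible values of $x$ are the elements $a\in H$ with $\Delta(a)=a\otimes 1+\varphi(g_x)\otimes a$ and $\varphi(h)^{-1}a\,\varphi(h)=\chi^x(h)\,a$ for all $h\in G$. For four (formally distinct) quantum variables $x_1,\dots,x_4$, a quadrilinear operation is a polynomial $W=\sum_{\pi\in S_4}\alpha_\pi x_{\pi(1)}x_{\pi(2)}x_{\pi(3)}x_{\pi(4)}$, $\alpha_\pi\in k$, in the free associative algebra $k\langle x_1,\dots,x_4\rangle$ whose value is skew primitive (that is, $\Delta(w)=w\otimes 1+g\otimes w$ for some grouplike $g\in H$) for all such $H,\varphi$ and all admissible values of $x_1,\dots,x_4$ in $H$. Put $p_{ij}=\chi^{x_i}(g_{x_j})$ and $\{p_{ij}\cdots p_{rs}\}=p_{ij}\cdots p_{rs}-p_{ji}^{-1}\cdots p_{sr}^{-1}$. For $\{i,j,l,s\}=\{1,2,3,4\}$ let $\Gamma_4^{(i,j)}$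 be the condition $$\{p_{ij}\}\neq 0,\qquad \{p_{ij}p_{il}p_{lj}\}\neq 0,\qquad \{p_{ij}p_{is}p_{sj}\}\neq 0 .$$ Write $[a\,b]_c=ab-c\,ba$. For elements $a_1,a_2,a_3$ carrying group elements $g_{a_i}$ and characters $\chi^{a_i}$, put $q_{ij}=\chi^{a_i}(g_{a_j})$. The main operation of rank 2 is $[\![a_1,a_2]\!]=[a_1a_2]_{q_{12}}$, defined if $q_{12}q_{21}=1$; the main operation of rank 3 is $$[\![a_1,a_2,a_3]\!]=[[a_1a_2]_{q_{12}}a_3]_{q_{13}q_{23}}-\frac{q_{31}^{-1}q_{32}^{-1}-q_{13}q_{23}}{q_{31}^{-1}-q_{13}}\,[[a_1a_3]_{q_{13}}a_2]_{q_{12}q_{32}},$$ defined if $\prod_{i\ne j}q_{ij}=1$ and $q_{ij}q_{ji}\neq1$ for all $i\neq j$. The values carry the products of the group elements and of the characters of the arguments, so that the operations can be superposed. Theorem 8.4. (1) A nonzero quadrilinear operation exists if and only if $\prod_{1\le i\neq j\le 4}p_{ij}=1$. (2) If this equality holds and $\Gamma_4^{(i,j)}$ holds for some pair $i\neq j$,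 then there are exactly two linearly independent quadrilinear operations, that is, the quadrilinear operations form a vector space of dimension 2. (3) If $\Gamma_4^{(i,j)}$ fails for every pair $i\neq j$, then every quadrilinear operation is a linear combination of multilinear superpositions, defined in the above sense, of the main operations of ranks 2 and 3 applied to $x_1,\dots,x_4$. -/

import Mathlib

open scoped TensorProduct

universe u v

/-- The data attached to a quantum variable over an abelian group `G`: an element `g` of `G` and a
character `chi : G → kˣ`. -/
@[ext]
structure QuantumVariable (k : Type u) (G : Type v) [Field k] [CommGroup G] where
  g : G
  chi : G →* kˣ

namespace QuantumVariable

variable {k : Type u} {G : Type v} [Field k] [CommGroup G]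

/-- `y.p z = χ^y(g_z)`. -/
def p (y z : QuantumVariable k G) : k := (y.chi z.g : k)

/-- The group element and the character carried by a product of elements of types `y` and `z`. -/
instance : Mul (QuantumVariable k G) := ⟨fun y z => ⟨y.g * z.g, y.chi * z.chi⟩⟩

end QuantumVariable

section QuantumOperations

variable {k : Type u} {G : Type v} [Field k] [CommGroup G]

/-- `h` is skew primitive in the Hopf algebra `H`: there is a grouplike `g` in `H` such that
`Δ(h) = h ⊗ 1 + g ⊗ h`. -/
def IsSkewPrimitive (k : Type u) {H : Type*} [Field k] [Ring H] [HopfAlgebra k H] (h : H) : Prop :=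
  ∃ g : H, IsGroupLikeElem k g ∧ Coalgebra.comul (R := k) h = h ⊗ₜ[k] (1 : H) + g ⊗ₜ[k] h

/-- `a` is an admissible value of the quantum variable `y` in a Hopf algebra `H` in which `G` is
interpreted by `φ : k[G] → H`: it is `φ(g_y)`-primitive, and it is a semi-invariant of
weight `χ^y`. -/
def IsValue {H : Type*} [Ring H] [HopfAlgebra k H] (φ : MonoidAlgebra k G →ₐc[k] H)
    (y : QuantumVariable k G) (a : H) : Prop :=
  Coalgebra.comul (R := k) a = a ⊗ₜ[k] (1 : H) + φ (MonoidAlgebra.of k G y.g) ⊗ₜ[k] a ∧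
  ∀ h : G, φ (MonoidAlgebra.of k G h⁻¹) * a * φ (MonoidAlgebra.of k G h) = (y.chi h : k) • a

/-- A quantum operation in the quantum variables `x 0, …, x (n - 1)`: an associative polynomial
whose value is skew primitive for all values of the quantum variables in all Hopf algebras
in which `G` is interpreted by grouplike elements. -/
def IsQuantumOperation {n : ℕ} (x : Fin n → QuantumVariable k G) (W : FreeAlgebra k (Fin n)) :
    Prop :=
  ∀ (H : Type (max u v)) [Ring H] [HopfAlgebra k H] (φ : MonoidAlgebra k G →ₐc[k] H)
    (a : Fin n → H), (∀ i, IsValue φ (x i) (a i)) → IsSkewPrimitive k (FreeAlgebra.lift k a W)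

/-- `W = ∑_π α_π x_{π(0)} ⋯ x_{π(n-1)}`, in distinct variables. -/
def IsMultilinear {n : ℕ} (W : FreeAlgebra k (Fin n)) : Prop :=
  ∃ α : Equiv.Perm (Fin n) → k,
    W = ∑ π, α π • (List.ofFn fun i => FreeAlgebra.ι k (π i)).prod

/-- Multilinear quantum operations; for `n = 4` these are the quadrilinear operations. -/
def IsMultilinearOperation {n : ℕ} (x : Fin n → QuantumVariable k G)
    (W : FreeAlgebra k (Fin n)) : Prop :=
  IsMultilinear W ∧ IsQuantumOperation x W

/-- The skew commutator `[a b]_c = ab - c ba`. -/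
def skewComm {A : Type*} [Ring A] [Algebra k A] (c : k) (a b : A) : A := a * b - c • (b * a)

/-- The main bilinear operation is defined on elements of types `y`, `z`. -/
def MainBilinearDefined (y z : QuantumVariable k G) : Prop := y.p z * z.p y = 1

/-- The main bilinear operation on elements of types `y`, `z`. -/
def mainBilinear {A : Type*} [Ring A] [Algebra k A] (y z : QuantumVariable k G) (a b : A) : A :=
  skewComm (y.p z) a b

/-- The main trilinear operation is defined on elements of types `y`, `z`, `t`. -/
def MainTrilinearDefined (y z t : QuantumVariable k G) : Prop :=
  y.p z * z.p y * (y.p t * t.p y) * (z.p t * t.p z) = 1 ∧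
  y.p z * z.p y ≠ 1 ∧ y.p t * t.p y ≠ 1 ∧ z.p t * t.p z ≠ 1

/-- The main trilinear operation on elements of types `y`, `z`, `t`. -/
def mainTrilinear {A : Type*} [Ring A] [Algebra k A] (y z t : QuantumVariable k G) (a b c : A) :
    A :=
  skewComm (y.p t * z.p t) (skewComm (y.p z) a b) c -
    (((t.p y)⁻¹ * (t.p z)⁻¹ - y.p t * z.p t) / ((t.p y)⁻¹ - y.p t)) •
      skewComm (y.p z * t.p z) (skewComm (y.p t) a c) b

/-- `IsSuperposition x P y`: the polynomial `P` is obtained from the quantum variables `x i` by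
successive application of the main operations of ranks 2 and 3, all of them defined where they are
applied, and `y` records the group element and the character of the result. -/
inductive IsSuperposition {n : ℕ} (x : Fin n → QuantumVariable k G) :
    FreeAlgebra k (Fin n) → QuantumVariable k G → Prop
  | var (i : Fin n) : IsSuperposition x (FreeAlgebra.ι k i) (x i)
  | bilinear {P Q : FreeAlgebra k (Fin n)} {y z : QuantumVariable k G}
      (hP : IsSuperposition x P y) (hQ : IsSuperposition x Q z) (h : MainBilinearDefined y z) :
      IsSuperposition x (mainBilinear y z P Q) (y * z)
  | trilinear {P Q R : FreeAlgebra k (Fin n)} {y z t : QuantumVariable k G}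
      (hP : IsSuperposition x P y) (hQ : IsSuperposition x Q z) (hR : IsSuperposition x R t)
      (h : MainTrilinearDefined y z t) :
      IsSuperposition x (mainTrilinear y z t P Q R) (y * z * t)

/-- The multilinear superpositions of the main operations of ranks 2 and 3. -/
def multilinearSuperpositions {n : ℕ} (x : Fin n → QuantumVariable k G) :
    Set (FreeAlgebra k (Fin n)) :=
  {P | IsMultilinear P ∧ ∃ y, IsSuperposition x P y}

/-- `{p_{ij} p_{kl} ⋯ p_{rs}} = p_{ij} p_{kl} ⋯ p_{rs} - p_{ji}⁻¹ p_{lk}⁻¹ ⋯ p_{sr}⁻¹`; the word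
is given as the list of its index pairs. -/
def brace {n : ℕ} (x : Fin n → QuantumVariable k G) (w : List (Fin n × Fin n)) : k :=
  (w.map fun e => (x e.1).p (x e.2)).prod - (w.map fun e => ((x e.2).p (x e.1))⁻¹).prod

/-- The condition `Γ₄^{(i,j)}`, for indices `i ≠ j`; `l` runs over the two other indices. -/
def Gamma4 (x : Fin 4 → QuantumVariable k G) (i j : Fin 4) : Prop :=
  brace x [(i, j)] ≠ 0 ∧ ∀ l, l ≠ i → l ≠ j → brace x [(i, j), (i, l), (l, j)] ≠ 0

end QuantumOperations

/-! Skew primitivity is tested in one Hopf algebra, the smash product `FreeHopf` of the free algebra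
with `k[G]`, whose generators are admissible values. Its tensor square acts on functions of pairs of
words, and indicator functions read off the components `u ⊗ w` of `Δ(W)`. All those with `w`
nonempty and shorter than 4 must vanish.

Fix a letter `x_i`. The components with `x_i` at the head of the left factor express every
coefficient of `W` through the coefficients of the words that begin with `x_i`. The pattern is that
of the long commutators `[[[x_i,x_b],x_c],x_d]`, so `W` is a combination of six of them with
coefficients `β` (`eq_commSum`). The components `x_b ⊗ x_i x_c x_d` give six linear relations on `β`
(`left_relation`). An alternating sum of components gives `(1 - T) β = 0`, where `T` is the product
of all `p_{jl}` (`total_relation`). Conversely, if `T = 1`, the six relations suffice: all other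
components of the comultiplication vanish as a consequence (`comul_commSum`).

Vanishing of the coefficients of these relations is governed by the edge weights `e_{jl} = p_{jl}
p_{lj}` on the complete graph with four vertices. The condition `Γ₄` says that an edge and both
triangles through it have weight different from 1. The system is then triangular with two free
parameters (`GenericPair.exists_basis`).

A triangle times the star of the opposite vertex has weight `T = 1`, so if `Γ₄` fails for every
edge, the number of vertices with nontrivial star leaves only three configurations
(`exceptional_of_not_gamma4`). In each of them an explicit solution `β` is nonzero, and grouping the
six commutators suitably turns the relations on `β` into the coefficients of superpositions of the
main operations. -/

/-! ### The universal test object: a Hopf algebra structure on the smash product. -/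

section FreeHopf

variable {k : Type u} {G : Type v} [Field k] [CommGroup G] {n : ℕ}

/-- The defining relations of the smash product of the free algebra on quantum variables with the
group algebra. -/
inductive FreeHopfRel (x : Fin n → QuantumVariable k G) :
    FreeAlgebra k (G ⊕ Fin n) → FreeAlgebra k (G ⊕ Fin n) → Prop
  | one : FreeHopfRel x (FreeAlgebra.ι k (Sum.inl 1)) 1
  | mul (g h : G) : FreeHopfRel x (FreeAlgebra.ι k (Sum.inl (g * h)))
      (FreeAlgebra.ι k (Sum.inl g) * FreeAlgebra.ι k (Sum.inl h))
  | comm (i : Fin n) (h : G) :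
      FreeHopfRel x (FreeAlgebra.ι k (Sum.inr i) * FreeAlgebra.ι k (Sum.inl h))
        (((x i).chi h : k) • (FreeAlgebra.ι k (Sum.inl h) * FreeAlgebra.ι k (Sum.inr i)))

/-- The smash product of the free algebra on quantum variables with the group algebra. -/
def FreeHopf (x : Fin n → QuantumVariable k G) : Type (max u v) := RingQuot (FreeHopfRel x)

namespace FreeHopf

variable (x : Fin n → QuantumVariable k G)

instance : Ring (FreeHopf x) := inferInstanceAs (Ring (RingQuot (FreeHopfRel x)))

instance : Algebra k (FreeHopf x) := inferInstanceAs (Algebra k (RingQuot (FreeHopfRel x)))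

/-- The quotient map. -/
def mk : FreeAlgebra k (G ⊕ Fin n) →ₐ[k] FreeHopf x := RingQuot.mkAlgHom k (FreeHopfRel x)

/-- The group elements of the smash product. -/
def grp : G →* FreeHopf x where
  toFun g := mk x (FreeAlgebra.ι k (Sum.inl g))
  map_one' := (RingQuot.mkAlgHom_rel k (FreeHopfRel.one (x := x))).trans (map_one (mk x))
  map_mul' g h := (RingQuot.mkAlgHom_rel k (FreeHopfRel.mul (x := x) g h)).trans
    (map_mul (mk x) _ _)

/-- The variables of the smash product. -/
def var (i : Fin n) : FreeHopf x := mk x (FreeAlgebra.ι k (Sum.inr i))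

theorem var_mul_grp (i : Fin n) (h : G) :
    var x i * grp x h = ((x i).chi h : k) • (grp x h * var x i) := by
  have := RingQuot.mkAlgHom_rel k (FreeHopfRel.comm (x := x) i h)
  rw [map_mul, map_smul, map_mul] at this
  exact this

/-- The universal property of the smash product. -/
def lift {B : Type*} [Ring B] [Algebra k B] (γ : G →* B) (ξ : Fin n → B)
    (h : ∀ i g, ξ i * γ g = ((x i).chi g : k) • (γ g * ξ i)) : FreeHopf x →ₐ[k] B :=
  RingQuot.liftAlgHom k ⟨FreeAlgebra.lift k (Sum.elim γ ξ), by
    intro a b r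
    induction r with
    | one => simp
    | mul g h => simp
    | comm i g => simpa using h i g⟩

section lift

variable {B : Type*} [Ring B] [Algebra k B] (γ : G →* B) (ξ : Fin n → B)
    (h : ∀ i g, ξ i * γ g = ((x i).chi g : k) • (γ g * ξ i))

@[simp] theorem lift_grp (g : G) : lift x γ ξ h (grp x g) = γ g := by
  refine (RingQuot.liftAlgHom_mkAlgHom_apply k _ _ _).trans ?_
  simp

@[simp] theorem lift_var (i : Fin n) : lift x γ ξ h (var x i) = ξ i := by
  refine (RingQuot.liftAlgHom_mkAlgHom_apply k _ _ _).trans ?_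
  simp

end lift

variable {x}

theorem algHom_ext {B : Type*} [Ring B] [Algebra k B] {f f' : FreeHopf x →ₐ[k] B}
    (hg : ∀ g, f (grp x g) = f' (grp x g)) (hv : ∀ i, f (var x i) = f' (var x i)) : f = f' := by
  refine RingQuot.ringQuot_ext' k f f' ?_
  ext z
  rcases z with g | i
  · exact hg g
  · exact hv i

theorem induction {C : FreeHopf x → Prop} (hc : ∀ r : k, C (algebraMap k _ r))
    (hg : ∀ g, C (grp x g)) (hv : ∀ i, C (var x i))
    (hadd : ∀ a b, C a → C b → C (a + b)) (hmul : ∀ a b, C a → C b → C (a * b)) (a) : C a := by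
  obtain ⟨w, rfl⟩ : ∃ w, mk x w = a := RingQuot.mkAlgHom_surjective k (FreeHopfRel x) a
  induction w using FreeAlgebra.induction with
  | grade0 r => rw [AlgHom.commutes]; exact hc r
  | grade1 z =>
    rcases z with g | i
    · exact hg g
    · exact hv i
  | mul a b ha hb => rw [map_mul]; exact hmul _ _ ha hb
  | add a b ha hb => rw [map_add]; exact hadd _ _ ha hb

variable (x)

/-- The comultiplication of the smash product. -/
noncomputable def comulHom : FreeHopf x →ₐ[k] FreeHopf x ⊗[k] FreeHopf x :=
  lift x
    { toFun := fun g => grp x g ⊗ₜ grp x g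
      map_one' := by simp [Algebra.TensorProduct.one_def]
      map_mul' := fun g h => by simp }
    (fun i => var x i ⊗ₜ 1 + grp x (x i).g ⊗ₜ var x i)
    -- The commutation relation survives because `G` is abelian, so that `g` passes `g_{x_i}` freely
    -- in the second summand.
    (fun i g => by
      change (var x i ⊗ₜ[k] 1 + grp x (x i).g ⊗ₜ[k] var x i) * (grp x g ⊗ₜ[k] grp x g) =
        ((x i).chi g : k) •
          ((grp x g ⊗ₜ[k] grp x g) * (var x i ⊗ₜ[k] 1 + grp x (x i).g ⊗ₜ[k] var x i))
      simp only [add_mul, mul_add, Algebra.TensorProduct.tmul_mul_tmul, one_mul, mul_one,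
        var_mul_grp, smul_add, TensorProduct.tmul_smul, TensorProduct.smul_tmul', ← map_mul,
        mul_comm (x i).g g])

/-- The counit of the smash product. -/
def counitHom : FreeHopf x →ₐ[k] k := lift x 1 0 (by simp)

/-- The antipode of the smash product, with values in the opposite algebra. -/
def antipodeHom : FreeHopf x →ₐ[k] (FreeHopf x)ᵐᵒᵖ :=
  lift x
    { toFun := fun g => MulOpposite.op (grp x g⁻¹)
      map_one' := by simp
      map_mul' := fun g h => by rw [← MulOpposite.op_mul, ← map_mul, mul_inv_rev] }
    (fun i => MulOpposite.op (-(grp x (x i).g⁻¹ * var x i)))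
    (fun i g => by
      have h := var_mul_grp x i g⁻¹
      rw [map_inv (x i).chi, Units.val_inv_eq_inv_val] at h
      have h' : grp x g⁻¹ * var x i = ((x i).chi g : k) • (var x i * grp x g⁻¹) := by
        rw [h, smul_smul, mul_inv_cancel₀ (Units.ne_zero _), one_smul]
      change MulOpposite.op (grp x g⁻¹ * -(grp x (x i).g⁻¹ * var x i)) =
        MulOpposite.op (((x i).chi g : k) • (-(grp x (x i).g⁻¹ * var x i) * grp x g⁻¹))
      congr 1
      rw [mul_neg, neg_mul, smul_neg, ← mul_assoc, ← map_mul, mul_comm, map_mul, mul_assoc, h',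
        mul_smul_comm, mul_assoc])

variable {x}

@[simp] theorem comulHom_grp (g : G) : comulHom x (grp x g) = grp x g ⊗ₜ grp x g :=
  lift_grp x _ _ _ g

@[simp] theorem comulHom_var (i : Fin n) :
    comulHom x (var x i) = var x i ⊗ₜ 1 + grp x (x i).g ⊗ₜ var x i := by
  simp [comulHom]

@[simp] theorem counitHom_grp (g : G) : counitHom x (grp x g) = 1 := by
  simp [counitHom]

@[simp] theorem counitHom_var (i : Fin n) : counitHom x (var x i) = 0 := by
  simp [counitHom]

noncomputable instance : Bialgebra k (FreeHopf x) :=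
  Bialgebra.ofAlgHom (comulHom x) (counitHom x)
    (algHom_ext (by simp) (by
      simp [TensorProduct.add_tmul, TensorProduct.tmul_add, Algebra.TensorProduct.one_def,
        add_assoc]))
    (algHom_ext (by simp) (by simp))
    (algHom_ext (by simp) (by simp))

theorem comul_eq (a : FreeHopf x) : Coalgebra.comul (R := k) a = comulHom x a := rfl

theorem counit_eq (a : FreeHopf x) : Coalgebra.counit (R := k) a = counitHom x a := rfl

variable (x)

/-- The antipode of the smash product. -/
def antipodeMap : FreeHopf x →ₗ[k] FreeHopf x :=
  (MulOpposite.opLinearEquiv k).symm.toLinearMap ∘ₗ (antipodeHom x).toLinearMap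

variable {x}

theorem antipodeMap_mul (a b : FreeHopf x) :
    antipodeMap x (a * b) = antipodeMap x b * antipodeMap x a := by
  simp [antipodeMap]

theorem antipodeMap_grp (g : G) : antipodeMap x (grp x g) = grp x g⁻¹ := by
  simp [antipodeMap, antipodeHom]

theorem antipodeMap_var (i : Fin n) :
    antipodeMap x (var x i) = -(grp x (x i).g⁻¹ * var x i) := by
  simp [antipodeMap, antipodeHom]

theorem antipodeMap_one : antipodeMap x 1 = 1 := by
  simp [antipodeMap]

/-- The antipode reverses products, so the contribution of `t` sits in the middle, where it
collapses to a scalar. This reduces the antipode axiom for a product to its factors, hence to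
generators. In the mirror statement below it is `t'` that collapses. -/
theorem mul_rTensor_antipodeMap_mul (t t' : FreeHopf x ⊗[k] FreeHopf x) (r : k)
    (h : LinearMap.mul' k _ ((antipodeMap x).rTensor _ t) = algebraMap k _ r) :
    LinearMap.mul' k _ ((antipodeMap x).rTensor _ (t * t')) =
      r • LinearMap.mul' k _ ((antipodeMap x).rTensor _ t') := by
  induction t' with
  | zero => simp
  | add a b ha hb => rw [mul_add, map_add, map_add, ha, hb, map_add, map_add, smul_add]
  | tmul a b =>
    have key : ∀ s : FreeHopf x ⊗[k] FreeHopf x,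
        LinearMap.mul' k _ ((antipodeMap x).rTensor _ (s * a ⊗ₜ b)) =
          antipodeMap x a * LinearMap.mul' k _ ((antipodeMap x).rTensor _ s) * b := by
      intro s
      induction s with
      | zero => simp
      | add s s' hs hs' => simp only [add_mul, map_add, hs, hs', mul_add]
      | tmul y z => simp [antipodeMap_mul, mul_assoc]
    rw [key, h]
    simp [Algebra.algebraMap_eq_smul_one]

theorem mul_lTensor_antipodeMap_mul (t t' : FreeHopf x ⊗[k] FreeHopf x) (r : k)
    (h : LinearMap.mul' k _ ((antipodeMap x).lTensor _ t') = algebraMap k _ r) :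
    LinearMap.mul' k _ ((antipodeMap x).lTensor _ (t * t')) =
      r • LinearMap.mul' k _ ((antipodeMap x).lTensor _ t) := by
  induction t with
  | zero => simp
  | add a b ha hb => rw [add_mul, map_add, map_add, ha, hb, map_add, map_add, smul_add]
  | tmul a b =>
    have key : ∀ s : FreeHopf x ⊗[k] FreeHopf x,
        LinearMap.mul' k _ ((antipodeMap x).lTensor _ (a ⊗ₜ b * s)) =
          a * LinearMap.mul' k _ ((antipodeMap x).lTensor _ s) * antipodeMap x b := by
      intro s
      induction s with
      | zero => simp
      | add s s' hs hs' => simp only [mul_add, add_mul, map_add, hs, hs']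
      | tmul y z => simp [antipodeMap_mul, mul_assoc]
    rw [key, h]
    simp [Algebra.algebraMap_eq_smul_one]

noncomputable instance : HopfAlgebra k (FreeHopf x) where
  antipode := antipodeMap x
  mul_antipode_rTensor_comul := by
    ext a
    simp only [LinearMap.comp_apply, comul_eq, counit_eq, Algebra.linearMap_apply]
    induction a using induction with
    | hc r =>
      simp [Algebra.algebraMap_eq_smul_one, Algebra.TensorProduct.one_def, antipodeMap_one]
    | hg g => simp [antipodeMap_grp, ← map_mul]
    | hv i => simp [antipodeMap_grp, antipodeMap_var]
    | hadd a b ha hb => simp [ha, hb]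
    | hmul a b ha hb =>
      rw [map_mul, mul_rTensor_antipodeMap_mul _ _ _ ha, hb, map_mul, map_mul, Algebra.smul_def]
  mul_antipode_lTensor_comul := by
    ext a
    simp only [LinearMap.comp_apply, comul_eq, counit_eq, Algebra.linearMap_apply]
    induction a using induction with
    | hc r =>
      simp [Algebra.algebraMap_eq_smul_one, Algebra.TensorProduct.one_def, antipodeMap_one]
    | hg g => simp [antipodeMap_grp, ← map_mul]
    | hv i => simp [antipodeMap_one, antipodeMap_var, ← mul_assoc, ← map_mul]
    | hadd a b ha hb => simp [ha, hb]
    | hmul a b ha hb =>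
      rw [map_mul, mul_lTensor_antipodeMap_mul _ _ _ hb, ha, map_mul, map_mul, Algebra.smul_def,
        Algebra.commutes]

variable (x)

/-- The interpretation of `G` in the smash product. -/
noncomputable def ofGroupAlgebra : MonoidAlgebra k G →ₐc[k] FreeHopf x :=
  BialgHom.ofAlgHom (MonoidAlgebra.lift k (FreeHopf x) G (grp x))
    (by ext g; simp [counit_eq]) (by ext g; simp [comul_eq])

variable {x}

@[simp] theorem ofGroupAlgebra_of (g : G) :
    ofGroupAlgebra x (MonoidAlgebra.of k G g) = grp x g := by
  simp [ofGroupAlgebra]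

theorem isValue_var (i : Fin n) : IsValue (ofGroupAlgebra x) (x i) (var x i) := by
  refine ⟨?_, fun h => ?_⟩
  · rw [ofGroupAlgebra_of, comul_eq, comulHom_var]
  · rw [ofGroupAlgebra_of, ofGroupAlgebra_of, mul_assoc, var_mul_grp, mul_smul_comm, ← mul_assoc,
      ← map_mul, inv_mul_cancel, map_one, one_mul]

end FreeHopf

end FreeHopf

/-! ### Reading off components of tensors by actions on functions of pairs of words. -/

section WordFunctions

variable {k : Type u} {G : Type v} [Field k] [CommGroup G] {n : ℕ}

/-- The value on `h` of the character of a word in quantum variables. -/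
def wordChar (x : Fin n → QuantumVariable k G) (h : G) (w : List (Fin n)) : k :=
  (w.map fun i => ((x i).chi h : k)).prod

@[simp] theorem wordChar_nil (x : Fin n → QuantumVariable k G) (h : G) : wordChar x h [] = 1 := rfl

@[simp] theorem wordChar_cons (x : Fin n → QuantumVariable k G) (h : G) (i : Fin n)
    (w : List (Fin n)) : wordChar x h (i :: w) = (x i).chi h * wordChar x h w := by
  simp [wordChar]

theorem wordChar_one (x : Fin n → QuantumVariable k G) (w : List (Fin n)) :
    wordChar x 1 w = 1 := by
  induction w with
  | nil => rfl
  | cons i w ih => simp [ih]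

theorem wordChar_mul (x : Fin n → QuantumVariable k G) (h h' : G) (w : List (Fin n)) :
    wordChar x (h * h') w = wordChar x h w * wordChar x h' w := by
  induction w with
  | nil => simp
  | cons i w ih => simp [ih]; ring

/-- A quantum variable acts on functions of pairs of words, through its comultiplication. -/
def shuffleStep (x : Fin n → QuantumVariable k G) (i : Fin n)
    (F : List (Fin n) → List (Fin n) → k) : List (Fin n) → List (Fin n) → k :=
  fun u w => F (i :: u) w + wordChar x (x i).g u * F u (i :: w)

namespace FreeHopf

variable (x : Fin n → QuantumVariable k G)

/-- The action of the smash product on functions of pairs of words through the first word. -/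
def actFst : FreeHopf x →ₐ[k] Module.End k (List (Fin n) → List (Fin n) → k) :=
  lift x
    { toFun := fun h =>
        { toFun := fun F u w => wordChar x h u * F u w
          map_add' := fun F F' => by ext; simp [mul_add]
          map_smul' := fun r F => by ext; simp [mul_left_comm] }
      map_one' := by ext; simp [wordChar_one]
      map_mul' := fun h h' => by
        ext F u w
        simp [wordChar_mul, mul_assoc] }
    (fun i =>
      { toFun := fun F u w => F (i :: u) w
        map_add' := fun F F' => rfl
        map_smul' := fun r F => rfl })
    (fun i h => by
      ext F u w
      simp [mul_assoc])

/-- The action of the smash product on functions of pairs of words through the second word. -/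
def actSnd : FreeHopf x →ₐ[k] Module.End k (List (Fin n) → List (Fin n) → k) :=
  lift x
    { toFun := fun h =>
        { toFun := fun F u w => wordChar x h w * F u w
          map_add' := fun F F' => by ext; simp [mul_add]
          map_smul' := fun r F => by ext; simp [mul_left_comm] }
      map_one' := by ext; simp [wordChar_one]
      map_mul' := fun h h' => by
        ext F u w
        simp [wordChar_mul, mul_assoc] }
    (fun i =>
      { toFun := fun F u w => F u (i :: w)
        map_add' := fun F F' => rfl
        map_smul' := fun r F => rfl })
    (fun i h => by
      ext F u w
      simp [mul_assoc])

variable {x}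

theorem actFst_grp (h : G) (F : List (Fin n) → List (Fin n) → k) (u w : List (Fin n)) :
    actFst x (grp x h) F u w = wordChar x h u * F u w := by
  rw [actFst, lift_grp]; rfl

theorem actSnd_grp (h : G) (F : List (Fin n) → List (Fin n) → k) (u w : List (Fin n)) :
    actSnd x (grp x h) F u w = wordChar x h w * F u w := by
  rw [actSnd, lift_grp]; rfl

theorem actFst_var (i : Fin n) (F : List (Fin n) → List (Fin n) → k) (u w : List (Fin n)) :
    actFst x (var x i) F u w = F (i :: u) w := by
  rw [actFst, lift_var]; rfl

theorem actSnd_var (i : Fin n) (F : List (Fin n) → List (Fin n) → k) (u w : List (Fin n)) :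
    actSnd x (var x i) F u w = F u (i :: w) := by
  rw [actSnd, lift_var]; rfl

theorem commute_actFst_actSnd (a b : FreeHopf x) : Commute (actFst x a) (actSnd x b) := by
  have comm : ∀ {f g : Module.End k (List (Fin n) → List (Fin n) → k)},
      (∀ F u w, f (g F) u w = g (f F) u w) → Commute f g := fun h =>
    LinearMap.ext fun F => funext fun u => funext fun w => h F u w
  induction a using induction with
  | hc r => rw [AlgHom.commutes]; exact Algebra.commute_algebraMap_left r _
  | hadd a a' h h' => rw [map_add]; exact h.add_left h'
  | hmul a a' h h' => rw [map_mul]; exact h.mul_left h'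
  | hg g =>
    induction b using induction with
    | hc r => rw [AlgHom.commutes]; exact Algebra.commute_algebraMap_right r _
    | hadd a a' h h' => rw [map_add]; exact h.add_right h'
    | hmul a a' h h' => rw [map_mul]; exact h.mul_right h'
    | hg g => exact comm fun F u w => by simp only [actFst_grp, actSnd_grp, mul_left_comm]
    | hv i => exact comm fun F u w => by simp only [actFst_grp, actSnd_var]
  | hv i =>
    induction b using induction with
    | hc r => rw [AlgHom.commutes]; exact Algebra.commute_algebraMap_right r _
    | hadd a a' h h' => rw [map_add]; exact h.add_right h'
    | hmul a a' h h' => rw [map_mul]; exact h.mul_right h'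
    | hg g => exact comm fun F u w => by simp only [actFst_var, actSnd_grp]
    | hv j => exact comm fun F u w => by simp only [actFst_var, actSnd_var]

variable (x)

/-- The action of the tensor square of the smash product on functions of pairs of words. -/
noncomputable def actTensor :
    FreeHopf x ⊗[k] FreeHopf x →ₐ[k] Module.End k (List (Fin n) → List (Fin n) → k) :=
  Algebra.TensorProduct.lift (actFst x) (actSnd x) commute_actFst_actSnd

variable {x}

theorem actTensor_tmul (a b : FreeHopf x) (F : List (Fin n) → List (Fin n) → k) :
    actTensor x (a ⊗ₜ b) F = actFst x a (actSnd x b F) := by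
  rw [actTensor, Algebra.TensorProduct.lift_tmul]; rfl

theorem actTensor_comul_var (i : Fin n) (F : List (Fin n) → List (Fin n) → k) :
    actTensor x (comulHom x (var x i)) F = shuffleStep x i F := by
  ext u w
  rw [comulHom_var, map_add, LinearMap.add_apply, actTensor_tmul, actTensor_tmul, map_one]
  simp [actFst_var, actFst_grp, actSnd_var, shuffleStep]

end FreeHopf

end WordFunctions

/-! ### Quadrilinear polynomials and the vanishing of mixed components. -/

section Quadrilinear

variable {k : Type u} {G : Type v} [Field k] [CommGroup G]

/-- The word `x_a x_b x_c x_d` in the free algebra. -/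
def word (k : Type u) [Field k] (a b c d : Fin 4) : FreeAlgebra k (Fin 4) :=
  FreeAlgebra.ι k a * FreeAlgebra.ι k b * FreeAlgebra.ι k c * FreeAlgebra.ι k d

theorem IsMultilinear.exists_coeff {W : FreeAlgebra k (Fin 4)} (h : IsMultilinear W) :
    ∃ α : Fin 4 → Fin 4 → Fin 4 → Fin 4 → k, W = ∑ π : Equiv.Perm (Fin 4),
      α (π 0) (π 1) (π 2) (π 3) • word k (π 0) (π 1) (π 2) (π 3) := by
  classical
  obtain ⟨α, rfl⟩ := h
  refine ⟨fun a b c d => if h : Function.Bijective ![a, b, c, d] then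
    α (Equiv.ofBijective _ h) else 0, Finset.sum_congr rfl fun π _ => ?_⟩
  have hπ : ![π 0, π 1, π 2, π 3] = π := by
    ext i; fin_cases i <;> rfl
  have hb : Function.Bijective ![π 0, π 1, π 2, π 3] := by rw [hπ]; exact π.bijective
  have he : Equiv.ofBijective _ hb = π := by
    ext i : 1
    exact congrFun hπ i
  simp only [dif_pos hb, he, word]
  simp [List.ofFn_succ, mul_assoc]

theorem sum_perm_fin_four {M : Type*} [AddCommMonoid M] (f : Fin 4 → Fin 4 → Fin 4 → Fin 4 → M) :
    ∑ π : Equiv.Perm (Fin 4), f (π 0) (π 1) (π 2) (π 3) =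
      ∑ a, ∑ b, ∑ c, ∑ d, if [a, b, c, d].Nodup then f a b c d else 0 := by
  classical
  trans ∑ p : Fin 4 × Fin 4 × Fin 4 × Fin 4,
    if [p.1, p.2.1, p.2.2.1, p.2.2.2].Nodup then f p.1 p.2.1 p.2.2.1 p.2.2.2 else 0
  swap
  · simp only [Fintype.sum_prod_type]
  rw [← Finset.sum_filter]
  refine Finset.sum_bij (fun π _ => (π 0, π 1, π 2, π 3)) ?_ ?_ ?_ ?_
  · intro π _
    simp
  · intro π _ σ _ h
    simp only [Prod.mk.injEq] at h
    ext i : 1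
    fin_cases i <;> simp [h]
  · rintro ⟨a, b, c, d⟩ h
    simp only [Finset.mem_filter, Finset.mem_univ, true_and] at h
    have hb : Function.Bijective ![a, b, c, d] := by
      rw [← Finite.injective_iff_bijective, ← List.nodup_ofFn]
      simpa [List.ofFn_succ] using h
    exact ⟨Equiv.ofBijective _ hb, Finset.mem_univ _, rfl⟩
  · intro π _
    rfl

theorem exists_perm_of_nodup {i b c d : Fin 4} (h : [i, b, c, d].Nodup) :
    ∃ e : Equiv.Perm (Fin 4), e 0 = i ∧ e 1 = b ∧ e 2 = c ∧ e 3 = d := by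
  have hb : Function.Bijective ![i, b, c, d] := by
    rw [← Finite.injective_iff_bijective, ← List.nodup_ofFn]
    simpa [List.ofFn_succ] using h
  exact ⟨Equiv.ofBijective _ hb, rfl, rfl, rfl, rfl⟩

/-- Relabelling by a permutation reduces to the standard labels. Keeping `i, b, c, d` arbitrary lets
each relation be proved once and used under every renaming of the letters. -/
theorem sum_perm_eq_of_nodup {M : Type*} [AddCommMonoid M]
    (f : Fin 4 → Fin 4 → Fin 4 → Fin 4 → M) {i b c d : Fin 4} (h : [i, b, c, d].Nodup) :
    ∑ π : Equiv.Perm (Fin 4), f (π 0) (π 1) (π 2) (π 3) =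
      f i b c d + f i b d c + f i c b d + f i c d b + f i d b c + f i d c b +
      (f b i c d + f b i d c + f b c i d + f b c d i + f b d i c + f b d c i) +
      (f c i b d + f c i d b + f c b i d + f c b d i + f c d i b + f c d b i) +
      (f d i b c + f d i c b + f d b i c + f d b c i + f d c i b + f d c b i) := by
  obtain ⟨e, rfl, rfl, rfl, rfl⟩ := exists_perm_of_nodup h
  rw [← Equiv.sum_comp (Equiv.mulLeft e)]
  refine (sum_perm_fin_four fun a b c d => f (e a) (e b) (e c) (e d)).trans ?_
  simp [Fin.sum_univ_four]
  abel

theorem FreeHopf.actTensor_comul_word (x : Fin 4 → QuantumVariable k G) (a b c d : Fin 4)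
    (F : List (Fin 4) → List (Fin 4) → k) :
    actTensor x (comulHom x (FreeAlgebra.lift k (var x) (word k a b c d))) F =
      shuffleStep x a (shuffleStep x b (shuffleStep x c (shuffleStep x d F))) := by
  simp only [word, map_mul, FreeAlgebra.lift_ι_apply, Module.End.mul_apply, actTensor_comul_var]

/-- The order is reversed because the outermost operator is the first letter and each letter is put
in front of those already placed. -/
theorem FreeHopf.actFst_word (x : Fin 4 → QuantumVariable k G) (a b c d : Fin 4)
    (F : List (Fin 4) → List (Fin 4) → k) (u w : List (Fin 4)) :
    actFst x (FreeAlgebra.lift k (var x) (word k a b c d)) F u w = F (d :: c :: b :: a :: u) w := by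
  simp only [word, map_mul, FreeAlgebra.lift_ι_apply, Module.End.mul_apply, actFst_var]

theorem FreeHopf.actSnd_word (x : Fin 4 → QuantumVariable k G) (a b c d : Fin 4)
    (F : List (Fin 4) → List (Fin 4) → k) (u w : List (Fin 4)) :
    actSnd x (FreeAlgebra.lift k (var x) (word k a b c d)) F u w = F u (d :: c :: b :: a :: w) := by
  simp only [word, map_mul, FreeAlgebra.lift_ι_apply, Module.End.mul_apply, actSnd_var]

open FreeHopf in
/-- The coefficients of a quadrilinear operation are orthogonal to quantum shuffles. -/
theorem IsQuantumOperation.sum_shuffle_eq_zero {x : Fin 4 → QuantumVariable k G}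
    {α : Fin 4 → Fin 4 → Fin 4 → Fin 4 → k}
    (hW : IsQuantumOperation x (∑ π : Equiv.Perm (Fin 4),
      α (π 0) (π 1) (π 2) (π 3) • word k (π 0) (π 1) (π 2) (π 3)))
    (F : List (Fin 4) → List (Fin 4) → k) (hF : ∀ u, F u [] = 0)
    (hF' : ∀ u w, 4 ≤ w.length → F u w = 0) :
    ∑ π : Equiv.Perm (Fin 4), α (π 0) (π 1) (π 2) (π 3) *
      shuffleStep x (π 0) (shuffleStep x (π 1) (shuffleStep x (π 2) (shuffleStep x (π 3) F)))
        [] [] = 0 := by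
  obtain ⟨g, -, hg⟩ := hW (FreeHopf x) (ofGroupAlgebra x) (var x) isValue_var
  -- The grouplike `g` is unknown, but `F` vanishes on long second words, so the term `g ⊗ W`
  -- contributes nothing whatever `g` is. The term `W ⊗ 1` is killed by the vanishing of `F` on the
  -- empty second word.
  have hS : actSnd x (FreeAlgebra.lift k (var x) (∑ π : Equiv.Perm (Fin 4),
      α (π 0) (π 1) (π 2) (π 3) • word k (π 0) (π 1) (π 2) (π 3))) F = 0 := by
    ext u w
    simp only [map_sum, map_smul, LinearMap.sum_apply, LinearMap.smul_apply, Finset.sum_apply,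
      Pi.smul_apply, actSnd_word]
    refine Finset.sum_eq_zero fun π _ => ?_
    rw [hF' _ _ (by simp), smul_zero]
  have hT := congrArg (fun t => actTensor x t F [] []) hg
  simp only [comul_eq, map_add, LinearMap.add_apply, actTensor_tmul, hS, map_zero, add_zero,
    map_one, Module.End.one_apply] at hT
  simp only [map_sum, map_smul, LinearMap.sum_apply, LinearMap.smul_apply, Finset.sum_apply,
    Pi.smul_apply, actTensor_comul_word, actFst_word, hF, smul_eq_mul, mul_zero,
    Finset.sum_const_zero] at hT
  exact hT

end Quadrilinear

/-! ### Linear relations forced on the coefficients. -/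

section Necessity

variable {k : Type u} {G : Type v} [Field k] [CommGroup G]

/-- The coefficients `α` define a quadrilinear operation. -/
def IsOperationCoeff (x : Fin 4 → QuantumVariable k G)
    (α : Fin 4 → Fin 4 → Fin 4 → Fin 4 → k) : Prop :=
  IsQuantumOperation x (∑ π : Equiv.Perm (Fin 4),
      α (π 0) (π 1) (π 2) (π 3) • word k (π 0) (π 1) (π 2) (π 3))

theorem IsOperationCoeff.shuffle_eq_zero {x : Fin 4 → QuantumVariable k G}
    {α : Fin 4 → Fin 4 → Fin 4 → Fin 4 → k} (h : IsOperationCoeff x α) (s t : List (Fin 4))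
    (ht : t ≠ []) (ht' : t.length < 4) :
    ∑ π : Equiv.Perm (Fin 4), α (π 0) (π 1) (π 2) (π 3) *
      shuffleStep x (π 0) (shuffleStep x (π 1) (shuffleStep x (π 2) (shuffleStep x (π 3)
        fun u w => if u = s ∧ w = t then 1 else 0))) [] [] = 0 := by
  refine IsQuantumOperation.sum_shuffle_eq_zero h _ (fun u => if_neg ?_)
    (fun u w hw => if_neg ?_)
  · rintro ⟨-, h⟩
    exact ht h.symm
  · rintro ⟨-, rfl⟩
    omega

variable {x : Fin 4 → QuantumVariable k G} {α : Fin 4 → Fin 4 → Fin 4 → Fin 4 → k}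

theorem ne_of_nodup {i b c d : Fin 4} (h : [i, b, c, d].Nodup) :
    (i ≠ b ∧ i ≠ c ∧ i ≠ d ∧ b ≠ c ∧ b ≠ d ∧ c ≠ d) ∧
      b ≠ i ∧ c ≠ i ∧ d ≠ i ∧ c ≠ b ∧ d ≠ b ∧ d ≠ c := by
  simp only [List.nodup_cons, List.mem_cons, List.not_mem_nil, not_or, or_false] at h
  obtain ⟨⟨hib, hic, hid⟩, ⟨hbc, hbd⟩, hcd, -⟩ := h
  exact ⟨⟨hib, hic, hid, hbc, hbd, hcd⟩, Ne.symm hib, Ne.symm hic, Ne.symm hid, Ne.symm hbc,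
    Ne.symm hbd, Ne.symm hcd⟩

theorem IsOperationCoeff.shuffle_eq_zero' (h : IsOperationCoeff x α) {i b c d : Fin 4}
    (hn : [i, b, c, d].Nodup) (s t : List (Fin 4)) (ht : t ≠ []) (ht' : t.length < 4) :
    ∀ f : Fin 4 → Fin 4 → Fin 4 → Fin 4 → k, (∀ a₁ a₂ a₃ a₄, f a₁ a₂ a₃ a₄ = α a₁ a₂ a₃ a₄ *
      shuffleStep x a₁ (shuffleStep x a₂ (shuffleStep x a₃ (shuffleStep x a₄
        fun u w => if u = s ∧ w = t then 1 else 0))) [] []) →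
      f i b c d + f i b d c + f i c b d + f i c d b + f i d b c + f i d c b +
      (f b i c d + f b i d c + f b c i d + f b c d i + f b d i c + f b d c i) +
      (f c i b d + f c i d b + f c b i d + f c b d i + f c d i b + f c d b i) +
      (f d i b c + f d i c b + f d b i c + f d b c i + f d c i b + f d c b i) = 0 := by
  intro f hf
  rw [← sum_perm_eq_of_nodup f hn, ← h.shuffle_eq_zero s t ht ht']
  exact Finset.sum_congr rfl fun π _ => hf _ _ _ _

/-- This is the component `x_i x_c x_d ⊗ x_b`, up to a group factor on the left; the words of the
test function are written backwards. Each factor `p` records a group element moved to the left past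
a letter. The names of the next five relations encode components in the same way. -/
theorem IsOperationCoeff.relation_icd_b (h : IsOperationCoeff x α) {i b c d : Fin 4}
    (hn : [i, b, c, d].Nodup) :
    (x i).p (x b) * (x c).p (x b) * (x d).p (x b) * α i c d b +
      (x i).p (x b) * (x c).p (x b) * α i c b d +
      (x i).p (x b) * α i b c d +
      α b i c d = 0 := by
  have := h.shuffle_eq_zero' hn [d, c, i] [b] (by simp) (by simp) _ fun _ _ _ _ => rfl
  simp [shuffleStep, ne_of_nodup hn] at this
  simp only [QuantumVariable.p]
  linear_combination this

theorem IsOperationCoeff.relation_id_bc (h : IsOperationCoeff x α) {i b c d : Fin 4}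
    (hn : [i, b, c, d].Nodup) :
    (x i).p (x b) * (x i).p (x c) * (x d).p (x b) * (x d).p (x c) * α i d b c +
      (x i).p (x b) * (x i).p (x c) * (x d).p (x c) * α i b d c +
      (x i).p (x b) * (x i).p (x c) * α i b c d +
      (x i).p (x c) * (x d).p (x c) * α b i d c +
      (x i).p (x c) * α b i c d +
      α b c i d = 0 := by
  have := h.shuffle_eq_zero' hn [d, i] [c, b] (by simp) (by simp) _ fun _ _ _ _ => rfl
  simp [shuffleStep, ne_of_nodup hn] at this
  simp only [QuantumVariable.p]
  linear_combination this

theorem IsOperationCoeff.relation_i_bcd (h : IsOperationCoeff x α) {i b c d : Fin 4}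
    (hn : [i, b, c, d].Nodup) :
    (x i).p (x b) * (x i).p (x c) * (x i).p (x d) * α i b c d +
      (x i).p (x c) * (x i).p (x d) * α b i c d +
      (x i).p (x d) * α b c i d +
      α b c d i = 0 := by
  have := h.shuffle_eq_zero' hn [i] [d, c, b] (by simp) (by simp) _ fun _ _ _ _ => rfl
  simp [shuffleStep, ne_of_nodup hn] at this
  simp only [QuantumVariable.p]
  linear_combination this

theorem IsOperationCoeff.relation_b_icd (h : IsOperationCoeff x α) {i b c d : Fin 4}
    (hn : [i, b, c, d].Nodup) :
    (x b).p (x i) * (x b).p (x c) * (x b).p (x d) * α b i c d +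
      (x b).p (x c) * (x b).p (x d) * α i b c d +
      (x b).p (x d) * α i c b d +
      α i c d b = 0 := by
  have := h.shuffle_eq_zero' hn [b] [d, c, i] (by simp) (by simp) _ fun _ _ _ _ => rfl
  simp [shuffleStep, ne_of_nodup hn] at this
  simp only [QuantumVariable.p]
  linear_combination this

theorem IsOperationCoeff.relation_bcd_i (h : IsOperationCoeff x α) {i b c d : Fin 4}
    (hn : [i, b, c, d].Nodup) :
    (x b).p (x i) * (x c).p (x i) * (x d).p (x i) * α b c d i +
      (x b).p (x i) * (x c).p (x i) * α b c i d +
      (x b).p (x i) * α b i c d +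
      α i b c d = 0 := by
  have := h.shuffle_eq_zero' hn [d, c, b] [i] (by simp) (by simp) _ fun _ _ _ _ => rfl
  simp [shuffleStep, ne_of_nodup hn] at this
  simp only [QuantumVariable.p]
  linear_combination this

theorem IsOperationCoeff.relation_bc_id (h : IsOperationCoeff x α) {i b c d : Fin 4}
    (hn : [i, b, c, d].Nodup) :
    (x b).p (x i) * (x b).p (x d) * (x c).p (x i) * (x c).p (x d) * α b c i d +
      (x b).p (x i) * (x b).p (x d) * (x c).p (x d) * α b i c d +
      (x b).p (x i) * (x b).p (x d) * α b i d c +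
      (x b).p (x d) * (x c).p (x d) * α i b c d +
      (x b).p (x d) * α i b d c +
      α i d b c = 0 := by
  have := h.shuffle_eq_zero' hn [c, b] [d, i] (by simp) (by simp) _ fun _ _ _ _ => rfl
  simp [shuffleStep, ne_of_nodup hn] at this
  simp only [QuantumVariable.p]
  linear_combination this

/-- The components with `x_i` at the head of the left factor can be solved successively for words
with `x_i` in second, third and fourth place, here and in the next two lemmas. -/
theorem IsOperationCoeff.coeff_snd (h : IsOperationCoeff x α) {i b c d : Fin 4}
    (hn : [i, b, c, d].Nodup) :
    α b i c d = -((x i).p (x b) * (α i b c d + (x c).p (x b) * α i c b d +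
      (x c).p (x b) * (x d).p (x b) * α i c d b)) := by
  linear_combination h.relation_icd_b hn

theorem IsOperationCoeff.coeff_thd (h : IsOperationCoeff x α) {i b c d : Fin 4}
    (hn : [i, b, c, d].Nodup) (hn' : [i, b, d, c].Nodup) :
    α b c i d = (x i).p (x b) * (x i).p (x c) * (x c).p (x b) * (α i c b d +
      (x d).p (x b) * α i c d b + (x d).p (x b) * (x d).p (x c) * α i d c b) := by
  linear_combination h.relation_id_bc hn - (x i).p (x c) * h.relation_icd_b hn -
    (x i).p (x c) * (x d).p (x c) * h.relation_icd_b hn'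

theorem IsOperationCoeff.coeff_fth (h : IsOperationCoeff x α) {i b c d : Fin 4}
    (hn : [i, b, c, d].Nodup) (hn' : [i, b, d, c].Nodup) :
    α b c d i = -((x i).p (x b) * (x i).p (x c) * (x i).p (x d) * (x c).p (x b) * (x d).p (x b) *
      (x d).p (x c) * α i d c b) := by
  linear_combination h.relation_i_bcd hn - (x i).p (x d) * h.coeff_thd hn hn' -
    (x i).p (x d) * (x i).p (x c) * h.coeff_snd hn

/-- In the component `x_b ⊗ x_i x_c x_d` only one word does not begin with `x_i`, and its
coefficient is eliminated. -/
theorem IsOperationCoeff.left_relation (h : IsOperationCoeff x α) {i b c d : Fin 4}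
    (hn : [i, b, c, d].Nodup) :
    (1 - (x i).p (x b) * (x b).p (x i)) * ((x b).p (x c) * (x b).p (x d)) * α i b c d +
      (1 - (x i).p (x b) * (x b).p (x i) * ((x c).p (x b) * (x b).p (x c))) * (x b).p (x d) *
        α i c b d +
      (1 - (x i).p (x b) * (x b).p (x i) * ((x c).p (x b) * (x b).p (x c)) *
        ((x d).p (x b) * (x b).p (x d))) * α i c d b = 0 := by
  linear_combination h.relation_b_icd hn -
    (x b).p (x i) * (x b).p (x c) * (x b).p (x d) * h.relation_icd_b hn

theorem IsOperationCoeff.total_relation (h : IsOperationCoeff x α) {i b c d : Fin 4}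
    (hn : [i, b, c, d].Nodup) (hn' : [i, b, d, c].Nodup) :
    (1 - (x i).p (x b) * (x b).p (x i) * ((x i).p (x c) * (x c).p (x i)) *
      ((x i).p (x d) * (x d).p (x i)) * ((x b).p (x c) * (x c).p (x b)) *
      ((x b).p (x d) * (x d).p (x b)) * ((x c).p (x d) * (x d).p (x c))) * α i d c b = 0 := by
  linear_combination (x b).p (x c) * (x b).p (x d) * (x c).p (x d) * h.relation_bcd_i hn -
    (x b).p (x c) * h.relation_bc_id hn + h.relation_b_icd hn' -
    (x b).p (x i) * (x c).p (x i) * (x d).p (x i) * (x b).p (x c) * (x b).p (x d) *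
      (x c).p (x d) * h.coeff_fth hn hn'

end Necessity

/-! ### Long skew commutators and their comultiplication. -/

section LongCommutators

variable {k : Type u} {G : Type v} [Field k] [CommGroup G]

/-- The skew commutator `[[a_i, a_b], a_c]`. -/
def tripleComm {A : Type*} [Ring A] [Algebra k A] (x : Fin 4 → QuantumVariable k G) (a : Fin 4 → A)
    (i b c : Fin 4) : A :=
  skewComm ((x i).p (x c) * (x b).p (x c)) (skewComm ((x i).p (x b)) (a i) (a b)) (a c)

/-- The skew commutator `[[[a_i, a_b], a_c], a_d]`. -/
def longComm {A : Type*} [Ring A] [Algebra k A] (x : Fin 4 → QuantumVariable k G) (a : Fin 4 → A)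
    (i b c d : Fin 4) : A :=
  skewComm ((x i).p (x d) * (x b).p (x d) * (x c).p (x d)) (tripleComm x a i b c) (a d)

/-- The linear combination of the long skew commutators that begin with `a_i`, with
coefficients `β`. -/
def commSum {A : Type*} [Ring A] [Algebra k A] (x : Fin 4 → QuantumVariable k G) (a : Fin 4 → A)
    (β : Fin 4 → Fin 4 → Fin 4 → k) (i b c d : Fin 4) : A :=
  β b c d • longComm x a i b c d + β b d c • longComm x a i b d c +
    β c b d • longComm x a i c b d + β c d b • longComm x a i c d b +
    β d b c • longComm x a i d b c + β d c b • longComm x a i d c b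

section Maps

variable {A B : Type*} [Ring A] [Algebra k A] [Ring B] [Algebra k B]

theorem map_skewComm (f : A →ₐ[k] B) (r : k) (a b : A) :
    f (skewComm r a b) = skewComm r (f a) (f b) := by
  simp [skewComm]

theorem map_longComm (f : A →ₐ[k] B) (x : Fin 4 → QuantumVariable k G) (a : Fin 4 → A)
    (i b c d : Fin 4) : f (longComm x a i b c d) = longComm x (fun j => f (a j)) i b c d := by
  simp [longComm, tripleComm, map_skewComm]

theorem map_commSum (f : A →ₐ[k] B) (x : Fin 4 → QuantumVariable k G) (a : Fin 4 → A)
    (β : Fin 4 → Fin 4 → Fin 4 → k) (i b c d : Fin 4) :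
    f (commSum x a β i b c d) = commSum x (fun j => f (a j)) β i b c d := by
  simp [commSum, map_longComm]

end Maps

section Comul

variable {H : Type*} [Ring H] [Algebra k H] (x : Fin 4 → QuantumVariable k G) (a g : Fin 4 → H)

/-- The element `g_i g_c g_d a_b ⊗ [[a_i, a_c], a_d]`. -/
def tensorOne (i b c d : Fin 4) : H ⊗[k] H :=
  (g i * (g c * (g d * a b))) ⊗ₜ tripleComm x a i c d

/-- The element `g_i g_d a_b a_c ⊗ [a_i, a_d]`. -/
def tensorTwo (i b c d : Fin 4) : H ⊗[k] H :=
  (g i * (g d * (a b * a c))) ⊗ₜ skewComm ((x i).p (x d)) (a i) (a d)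

/-- The element `g_i a_b a_c a_d ⊗ a_i`. -/
def tensorThree (k : Type u) [Field k] [Algebra k H] (a g : Fin 4 → H) (i b c d : Fin 4) :
    H ⊗[k] H :=
  (g i * (a b * (a c * a d))) ⊗ₜ a i

variable {x a g}

/-- The constant of each skew commutator is the one that cancels the terms where a group element of
the new letter meets a left factor containing `a_i`. Hence, apart from the term with right factor 1,
`a_i` lies in the right factor, which is again a nested commutator headed by `a_i`. -/
theorem comul_longComm (hg : ∀ j l, g j * g l = g l * g j)
    (hag : ∀ j l, a j * g l = (x j).p (x l) • (g l * a j)) (i b c d : Fin 4) :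
    longComm x (fun j => a j ⊗ₜ[k] (1 : H) + g j ⊗ₜ[k] a j) i b c d =
      longComm x a i b c d ⊗ₜ[k] 1 + (g i * g b * g c * g d) ⊗ₜ[k] longComm x a i b c d +
      ((1 - (x i).p (x b) * (x b).p (x i)) * ((x b).p (x c) * (x b).p (x d))) •
        tensorOne x a g i b c d +
      ((1 - (x i).p (x c) * (x c).p (x i) * ((x b).p (x c) * (x c).p (x b))) * (x c).p (x d)) •
        tensorOne x a g i c b d +
      (1 - (x i).p (x d) * (x d).p (x i) * ((x b).p (x d) * (x d).p (x b)) *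
        ((x c).p (x d) * (x d).p (x c))) • tensorOne x a g i d b c +
      ((1 - (x i).p (x b) * (x b).p (x i)) * ((x b).p (x d) * (x c).p (x d))) •
        (tensorTwo x a g i b c d -
          ((x b).p (x c) * ((x i).p (x c) * (x c).p (x i))) • tensorTwo x a g i c b d) +
      ((1 - (x i).p (x b) * (x b).p (x i)) * (x b).p (x c)) •
        (tensorTwo x a g i b d c -
          ((x b).p (x d) * ((x i).p (x d) * (x d).p (x i)) * ((x c).p (x d) * (x d).p (x c))) •
            tensorTwo x a g i d b c) +
      (1 - (x i).p (x c) * (x c).p (x i) * ((x b).p (x c) * (x c).p (x b))) •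
        (tensorTwo x a g i c d b -
          ((x c).p (x d) * ((x i).p (x d) * (x d).p (x i)) * ((x b).p (x d) * (x d).p (x b))) •
            tensorTwo x a g i d c b) +
      (1 - (x i).p (x b) * (x b).p (x i)) •
        (tensorThree k a g i b c d -
          ((x b).p (x c) * ((x i).p (x c) * (x c).p (x i))) • tensorThree k a g i c b d -
          ((x b).p (x d) * (x c).p (x d) * ((x i).p (x d) * (x d).p (x i))) •
            (tensorThree k a g i d b c -
              ((x b).p (x c) * ((x i).p (x c) * (x c).p (x i))) • tensorThree k a g i d c b)) := by
  have hg' : ∀ j l z, g j * (g l * z) = g l * (g j * z) := fun j l z => by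
    rw [← mul_assoc, hg, mul_assoc]
  have hag' : ∀ j l z, a j * (g l * z) = (x j).p (x l) • (g l * (a j * z)) := fun j l z => by
    rw [← mul_assoc, hag, smul_mul_assoc, mul_assoc]
  simp only [longComm, tripleComm, skewComm, tensorOne, tensorTwo, tensorThree, mul_add, add_mul,
    mul_sub, sub_mul, Algebra.TensorProduct.tmul_mul_tmul, one_mul, mul_one, mul_assoc,
    smul_add, smul_sub, TensorProduct.tmul_smul, ← TensorProduct.smul_tmul', TensorProduct.sub_tmul,
    TensorProduct.tmul_sub, smul_mul_assoc, mul_smul_comm, hag, hag', smul_smul]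
  -- Commutativity acts as an ordered rewriting rule that sorts the group elements, so that equal
  -- tensors become syntactically equal.
  simp only [hg, hg']
  module

end Comul

end LongCommutators

/-! ### The left relations and trivial total product give skew primitivity. -/

section Sufficiency

variable {k : Type u} {G : Type v} [Field k] [CommGroup G]

/-- The linear relation on the coefficients `β` of a combination of long skew commutators which
annihilates the component of its comultiplication with left factor `x_b` and right factor
`[[x_i, x_c], x_d]`. -/
def LeftRelation (x : Fin 4 → QuantumVariable k G) (β : Fin 4 → Fin 4 → Fin 4 → k)
    (i b c d : Fin 4) : Prop :=
  (1 - (x i).p (x b) * (x b).p (x i)) * ((x b).p (x c) * (x b).p (x d)) * β b c d +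
    (1 - (x i).p (x b) * (x b).p (x i) * ((x c).p (x b) * (x b).p (x c))) * (x b).p (x d) *
      β c b d +
    (1 - (x i).p (x b) * (x b).p (x i) * ((x c).p (x b) * (x b).p (x c)) *
      ((x d).p (x b) * (x b).p (x d))) * β c d b = 0

/-- All left relations on the coefficients of a combination of long skew commutators that begin
with `x_i`. -/
def LeftRelations (x : Fin 4 → QuantumVariable k G) (β : Fin 4 → Fin 4 → Fin 4 → k)
    (i b c d : Fin 4) : Prop :=
  (LeftRelation x β i b c d ∧ LeftRelation x β i b d c) ∧
    (LeftRelation x β i c b d ∧ LeftRelation x β i c d b) ∧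
    LeftRelation x β i d b c ∧ LeftRelation x β i d c b

/-- The product of all `p_{jl}`, `j ≠ l`, over the indices `i, b, c, d`. -/
def totalProd (x : Fin 4 → QuantumVariable k G) (i b c d : Fin 4) : k :=
  (x i).p (x b) * (x b).p (x i) * ((x i).p (x c) * (x c).p (x i)) *
    ((x i).p (x d) * (x d).p (x i)) * ((x b).p (x c) * (x c).p (x b)) *
    ((x b).p (x d) * (x d).p (x b)) * ((x c).p (x d) * (x d).p (x c))

theorem QuantumVariable.p_ne_zero (y z : QuantumVariable k G) : y.p z ≠ 0 := Units.ne_zero _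

variable {x : Fin 4 → QuantumVariable k G} {β : Fin 4 → Fin 4 → Fin 4 → k} {i b c d : Fin 4}

/-- The coefficient of `x_b x_c ⊗ [x_i, x_d]`. -/
theorem LeftRelation.two (hp : totalProd x i b c d = 1) (h₁ : LeftRelation x β i b c d)
    (h₂ : LeftRelation x β i b d c) (h₃ : LeftRelation x β i d c b) :
    (1 - (x i).p (x b) * (x b).p (x i)) * ((x b).p (x d) * (x c).p (x d)) * β b c d -
      (1 - (x i).p (x c) * (x c).p (x i)) * ((x c).p (x d) * (x b).p (x d)) *
        ((x c).p (x b) * ((x i).p (x b) * (x b).p (x i))) * β c b d +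
      (1 - (x i).p (x b) * (x b).p (x i)) * (x b).p (x d) * β b d c -
      (1 - (x i).p (x c) * (x c).p (x i)) * (x c).p (x d) *
        ((x c).p (x b) * ((x i).p (x b) * (x b).p (x i)) * ((x d).p (x b) * (x b).p (x d))) *
        β c d b +
      (1 - (x i).p (x b) * (x b).p (x i) * ((x d).p (x b) * (x b).p (x d))) * β d b c -
      (1 - (x i).p (x c) * (x c).p (x i) * ((x d).p (x c) * (x c).p (x d))) *
        ((x c).p (x b) * ((x i).p (x b) * (x b).p (x i)) * ((x d).p (x b) * (x b).p (x d))) *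
        β d c b = 0 := by
  unfold LeftRelation at h₁ h₂ h₃
  unfold totalProd at hp
  refine (mul_eq_zero.mp ?_).resolve_left ((x b).p_ne_zero (x c))
  -- After multiplication by `p_{bc}`, the left relations leave only a multiple of the total product
  -- minus 1.
  linear_combination (x c).p (x d) * h₁ + h₂ + (x i).p (x b) * (x b).p (x i) *
    ((x i).p (x c) * (x c).p (x i)) * ((x b).p (x c) * (x c).p (x b)) *
    ((x b).p (x d) * (x c).p (x d)) * h₃ +
    ((x b).p (x d) * (x c).p (x d) * β c b d + (x c).p (x d) * β c d b + β d c b) * hp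

/-- The coefficient of `x_b x_c x_d ⊗ x_i`. -/
theorem LeftRelation.three (hp : totalProd x i b c d = 1) (h₁ : LeftRelation x β i b c d)
    (h₃ : LeftRelation x β i d c b) :
    (1 - (x i).p (x b) * (x b).p (x i)) * β b c d -
      (1 - (x i).p (x c) * (x c).p (x i)) * ((x c).p (x b) * ((x i).p (x b) * (x b).p (x i))) *
        β c b d -
      (1 - (x i).p (x c) * (x c).p (x i)) * ((x c).p (x b) * (x d).p (x b) *
        ((x i).p (x b) * (x b).p (x i))) * β c d b +
      (1 - (x i).p (x d) * (x d).p (x i)) * ((x d).p (x b) * (x c).p (x b) *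
        ((x i).p (x b) * (x b).p (x i)) * ((x d).p (x c) * ((x i).p (x c) * (x c).p (x i)))) *
        β d c b = 0 := by
  unfold LeftRelation at h₁ h₃
  unfold totalProd at hp
  refine (mul_eq_zero.mp ?_).resolve_left
    (mul_ne_zero ((x b).p_ne_zero (x c)) ((x b).p_ne_zero (x d)))
  linear_combination h₁ + (x i).p (x b) * (x b).p (x i) *
    ((x i).p (x c) * (x c).p (x i)) * ((x b).p (x c) * (x c).p (x b)) * (x b).p (x d) * h₃ +
    ((x b).p (x d) * β c b d + β c d b) * hp

theorem totalProd_swap₁ (i b c d : Fin 4) : totalProd x i c b d = totalProd x i b c d := by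
  unfold totalProd; ring

theorem totalProd_swap₂ (i b c d : Fin 4) : totalProd x i b d c = totalProd x i b c d := by
  unfold totalProd; ring

/-- Each of the 18 mixed tensors has a vanishing coefficient: a left relation for right factors of
degree 3, `LeftRelation.two` and `LeftRelation.three` for degrees 2 and 1. The six leading group
elements coincide by commutativity. -/
theorem comul_commSum {H : Type*} [Ring H] [Algebra k H] {a g : Fin 4 → H}
    (hg : ∀ j l, g j * g l = g l * g j)
    (hag : ∀ j l, a j * g l = (x j).p (x l) • (g l * a j))
    (hp : totalProd x i b c d = 1) (h : LeftRelations x β i b c d) :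
    commSum x (fun j => a j ⊗ₜ[k] (1 : H) + g j ⊗ₜ[k] a j) β i b c d =
      commSum x a β i b c d ⊗ₜ[k] 1 + (g i * g b * g c * g d) ⊗ₜ[k] commSum x a β i b c d := by
  obtain ⟨⟨hbcd, hbdc⟩, ⟨hcbd, hcdb⟩, hdbc, hdcb⟩ := h
  have pbcd := hp
  have pbdc : totalProd x i b d c = 1 := (totalProd_swap₂ ..).trans hp
  have pcbd : totalProd x i c b d = 1 := (totalProd_swap₁ ..).trans hp
  have pcdb : totalProd x i c d b = 1 := (totalProd_swap₂ ..).trans pcbd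
  have pdbc : totalProd x i d b c = 1 := (totalProd_swap₁ ..).trans pbdc
  have pdcb : totalProd x i d c b = 1 := (totalProd_swap₂ ..).trans pdbc
  have G₁ : g i * g b * g d * g c = g i * g b * g c * g d := by
    rw [mul_assoc, hg d c, ← mul_assoc]
  have G₂ : g i * g c * g b * g d = g i * g b * g c * g d := by
    rw [mul_assoc (g i), hg c b, ← mul_assoc]
  have G₃ : g i * g c * g d * g b = g i * g b * g c * g d := by
    rw [← G₂, mul_assoc, hg d b, ← mul_assoc]
  have G₄ : g i * g d * g b * g c = g i * g b * g c * g d := by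
    rw [← G₁, mul_assoc (g i), hg d b, ← mul_assoc]
  have G₅ : g i * g d * g c * g b = g i * g b * g c * g d := by
    rw [← G₄, mul_assoc, hg c b, ← mul_assoc]
  simp only [commSum, comul_longComm hg hag, G₁, G₂, G₃, G₄, G₅, TensorProduct.add_tmul,
    TensorProduct.tmul_add, TensorProduct.tmul_smul, ← TensorProduct.smul_tmul']
  unfold LeftRelation at hbcd hbdc hcbd hcdb hdbc hdcb
  linear_combination (norm := module)
    hbcd • tensorOne x a g i b c d +
    (LeftRelation.two pbcd hbcd hbdc hdcb) • tensorTwo x a g i b c d +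
    (LeftRelation.three pbcd hbcd hdcb) • tensorThree k a g i b c d +
    hbdc • tensorOne x a g i b d c +
    (LeftRelation.two pbdc hbdc hbcd hcdb) • tensorTwo x a g i b d c +
    (LeftRelation.three pbdc hbdc hcdb) • tensorThree k a g i b d c +
    hcbd • tensorOne x a g i c b d +
    (LeftRelation.two pcbd hcbd hcdb hdbc) • tensorTwo x a g i c b d +
    (LeftRelation.three pcbd hcbd hdbc) • tensorThree k a g i c b d +
    hcdb • tensorOne x a g i c d b +
    (LeftRelation.two pcdb hcdb hcbd hbdc) • tensorTwo x a g i c d b +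
    (LeftRelation.three pcdb hcdb hbdc) • tensorThree k a g i c d b +
    hdbc • tensorOne x a g i d b c +
    (LeftRelation.two pdbc hdbc hdcb hcbd) • tensorTwo x a g i d b c +
    (LeftRelation.three pdbc hdbc hcbd) • tensorThree k a g i d b c +
    hdcb • tensorOne x a g i d c b +
    (LeftRelation.two pdcb hdcb hdbc hbcd) • tensorTwo x a g i d c b +
    (LeftRelation.three pdcb hdcb hbcd) • tensorThree k a g i d c b

end Sufficiency

/-! ### Every quadrilinear operation is a combination of six long commutators. -/

section Structure

variable {k : Type u} {G : Type v} [Field k] [CommGroup G]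

theorem IsMultilinear.add {n : ℕ} {W W' : FreeAlgebra k (Fin n)} (h : IsMultilinear W)
    (h' : IsMultilinear W') : IsMultilinear (W + W') := by
  obtain ⟨α, rfl⟩ := h
  obtain ⟨α', rfl⟩ := h'
  exact ⟨α + α', by simp [add_smul, Finset.sum_add_distrib]⟩

theorem IsMultilinear.smul {n : ℕ} {W : FreeAlgebra k (Fin n)} (r : k) (h : IsMultilinear W) :
    IsMultilinear (r • W) := by
  obtain ⟨α, rfl⟩ := h
  exact ⟨r • α, by simp [Finset.smul_sum, smul_smul]⟩

theorem IsMultilinear.sub {n : ℕ} {W W' : FreeAlgebra k (Fin n)} (h : IsMultilinear W)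
    (h' : IsMultilinear W') : IsMultilinear (W - W') := by
  rw [sub_eq_add_neg, ← neg_one_smul k W']
  exact h.add (h'.smul _)

theorem isMultilinear_word {i b c d : Fin 4} (hn : [i, b, c, d].Nodup) :
    IsMultilinear (word k i b c d) := by
  classical
  obtain ⟨e, rfl, rfl, rfl, rfl⟩ := exists_perm_of_nodup hn
  exact ⟨Pi.single e 1, by
    rw [Finset.sum_eq_single e (fun π _ h => by rw [Pi.single_eq_of_ne h, zero_smul]) (by simp)]
    simp [word, List.ofFn_succ, mul_assoc]⟩

theorem longComm_eq_words (x : Fin 4 → QuantumVariable k G) (i b c d : Fin 4) :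
    longComm x (FreeAlgebra.ι k) i b c d =
      word k i b c d - (x i).p (x b) • word k b i c d -
      ((x i).p (x c) * (x b).p (x c)) • (word k c i b d - (x i).p (x b) • word k c b i d) -
      ((x i).p (x d) * (x b).p (x d) * (x c).p (x d)) •
        (word k d i b c - (x i).p (x b) • word k d b i c -
          ((x i).p (x c) * (x b).p (x c)) •
            (word k d c i b - (x i).p (x b) • word k d c b i)) := by
  simp only [longComm, tripleComm, skewComm, word, mul_sub, sub_mul, smul_mul_assoc,
    mul_smul_comm, mul_assoc]

theorem nodup_perms {i b c d : Fin 4} (hn : [i, b, c, d].Nodup) :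
    [i, b, d, c].Nodup ∧ [i, c, b, d].Nodup ∧ [i, c, d, b].Nodup ∧ [i, d, b, c].Nodup ∧
      [i, d, c, b].Nodup := by
  have h := ne_of_nodup hn
  simp [h]

theorem isMultilinear_longComm (x : Fin 4 → QuantumVariable k G) {i b c d : Fin 4}
    (hn : [i, b, c, d].Nodup) : IsMultilinear (longComm x (FreeAlgebra.ι k) i b c d) := by
  rw [longComm_eq_words]
  have key : ∀ {s t l m : Fin 4}, [s, t, l, m].Nodup → IsMultilinear (word k s t l m) :=
    isMultilinear_word
  refine .sub (.sub (.sub (key ?_) (.smul _ (key ?_))) (.smul _ (.sub (key ?_) (.smul _ (key ?_)))))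
    (.smul _ (.sub (.sub (key ?_) (.smul _ (key ?_))) (.smul _ (.sub (key ?_)
      (.smul _ (key ?_))))))
  all_goals simp [ne_of_nodup hn]

theorem isMultilinear_commSum (x : Fin 4 → QuantumVariable k G) (β : Fin 4 → Fin 4 → Fin 4 → k)
    {i b c d : Fin 4} (hn : [i, b, c, d].Nodup) :
    IsMultilinear (commSum x (FreeAlgebra.ι k) β i b c d) := by
  obtain ⟨h₁, h₂, h₃, h₄, h₅⟩ := nodup_perms hn
  exact .add (.add (.add (.add (.add (.smul _ (isMultilinear_longComm x hn))
    (.smul _ (isMultilinear_longComm x h₁))) (.smul _ (isMultilinear_longComm x h₂)))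
    (.smul _ (isMultilinear_longComm x h₃))) (.smul _ (isMultilinear_longComm x h₄)))
    (.smul _ (isMultilinear_longComm x h₅))

theorem isQuantumOperation_commSum {x : Fin 4 → QuantumVariable k G}
    {β : Fin 4 → Fin 4 → Fin 4 → k} {i b c d : Fin 4} (hp : totalProd x i b c d = 1)
    (h : LeftRelations x β i b c d) :
    IsQuantumOperation x (commSum x (FreeAlgebra.ι k) β i b c d) := by
  intro H _ _ φ a ha
  have hgl : ∀ g : G, IsGroupLikeElem k (φ (MonoidAlgebra.of k G g)) := fun g =>
    (MonoidAlgebra.isGroupLikeElem_of g).map φ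
  refine ⟨_, ((((hgl (x i).g).mul (hgl (x b).g)).mul (hgl (x c).g)).mul (hgl (x d).g)), ?_⟩
  rw [map_commSum]
  simp only [FreeAlgebra.lift_ι_apply]
  rw [← comul_commSum (g := fun j => φ (MonoidAlgebra.of k G (x j).g)) _ _ hp h,
    ← Bialgebra.comulAlgHom_apply, map_commSum]
  · simp only [Bialgebra.comulAlgHom_apply, (ha _).1]
  · intro j l
    rw [← map_mul, ← map_mul, ← map_mul, ← map_mul, mul_comm]
  · intro j l
    rw [QuantumVariable.p, ← mul_smul_comm, ← (ha j).2 (x l).g, ← mul_assoc, ← mul_assoc,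
      ← map_mul, ← map_mul, mul_inv_cancel, map_one, map_one, one_mul]

/-- Each long commutator contains exactly one word beginning with `x_i`, with coefficient 1; the
formulas for the remaining coefficients are those of its expansion. -/
theorem IsOperationCoeff.eq_commSum {x : Fin 4 → QuantumVariable k G}
    {α : Fin 4 → Fin 4 → Fin 4 → Fin 4 → k} (h : IsOperationCoeff x α) {i b c d : Fin 4}
    (hn : [i, b, c, d].Nodup) :
    ∑ π : Equiv.Perm (Fin 4), α (π 0) (π 1) (π 2) (π 3) • word k (π 0) (π 1) (π 2) (π 3) =
      commSum x (FreeAlgebra.ι k) (α i) i b c d := by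
  obtain ⟨h₁, h₂, h₃, h₄, h₅⟩ := nodup_perms hn
  rw [sum_perm_eq_of_nodup (fun a₁ a₂ a₃ a₄ => α a₁ a₂ a₃ a₄ • word k a₁ a₂ a₃ a₄) hn]
  simp only [commSum, longComm_eq_words, h.coeff_snd hn, h.coeff_snd h₁, h.coeff_snd h₂,
    h.coeff_snd h₃, h.coeff_snd h₄, h.coeff_snd h₅, h.coeff_thd hn h₁, h.coeff_thd h₁ hn,
    h.coeff_thd h₂ h₃, h.coeff_thd h₃ h₂, h.coeff_thd h₄ h₅, h.coeff_thd h₅ h₄,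
    h.coeff_fth hn h₁, h.coeff_fth h₁ hn,
    h.coeff_fth h₂ h₃, h.coeff_fth h₃ h₂, h.coeff_fth h₄ h₅, h.coeff_fth h₅ h₄]
  module

/-- A quadrilinear operation is a combination of long skew commutators, the coefficients of which
satisfy the left relations. -/
theorem IsMultilinearOperation.exists_commSum {x : Fin 4 → QuantumVariable k G}
    {W : FreeAlgebra k (Fin 4)} (hW : IsMultilinearOperation x W) {i b c d : Fin 4}
    (hn : [i, b, c, d].Nodup) : ∃ β : Fin 4 → Fin 4 → Fin 4 → k,
      W = commSum x (FreeAlgebra.ι k) β i b c d ∧ LeftRelations x β i b c d ∧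
        (totalProd x i b c d = 1 ∨ W = 0) := by
  obtain ⟨hm, ho⟩ := hW
  obtain ⟨α, rfl⟩ := hm.exists_coeff
  have h : IsOperationCoeff x α := ho
  obtain ⟨h₁, h₂, h₃, h₄, h₅⟩ := nodup_perms hn
  refine ⟨α i, h.eq_commSum hn, ⟨⟨h.left_relation hn, h.left_relation h₁⟩, ⟨h.left_relation h₂,
    h.left_relation h₃⟩, h.left_relation h₄, h.left_relation h₅⟩, ?_⟩
  rw [or_iff_not_imp_left]
  intro hp
  have hp' : 1 - totalProd x i b c d ≠ 0 := sub_ne_zero.mpr (Ne.symm hp)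
  have key : ∀ {b' c' d'}, (1 - totalProd x i b' c' d') * α i d' c' b' = 0 →
      totalProd x i b' c' d' = totalProd x i b c d → α i d' c' b' = 0 := fun h e =>
    (mul_eq_zero.mp h).resolve_left (e ▸ hp')
  -- If the total product is not 1, the total relations, taken over all orders of `b, c, d`, kill
  -- all six coefficients.
  rw [h.eq_commSum hn, commSum, key (h.total_relation hn h₁) rfl,
    key (h.total_relation h₁ hn) (by unfold totalProd; ring),
    key (h.total_relation h₂ h₃) (by unfold totalProd; ring),
    key (h.total_relation h₃ h₂) (by unfold totalProd; ring),
    key (h.total_relation h₄ h₅) (by unfold totalProd; ring),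
    key (h.total_relation h₅ h₄) (by unfold totalProd; ring)]
  simp

/-- The coefficient of the word `x_a x_b x_c x_d`. -/
def wordCoeff (x : Fin 4 → QuantumVariable k G) (a b c d : Fin 4) :
    FreeAlgebra k (Fin 4) →ₗ[k] k where
  toFun W := FreeHopf.actFst x (FreeAlgebra.lift k (FreeHopf.var x) W)
    (fun u _ => if u = [d, c, b, a] then 1 else 0) [] []
  map_add' _ _ := by simp
  map_smul' _ _ := by simp

theorem wordCoeff_word (x : Fin 4 → QuantumVariable k G) (a b c d a' b' c' d' : Fin 4) :
    wordCoeff x a b c d (word k a' b' c' d') =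
      if d' = d ∧ c' = c ∧ b' = b ∧ a' = a then 1 else 0 := by
  simp [wordCoeff, FreeHopf.actFst_word]

theorem wordCoeff_commSum (x : Fin 4 → QuantumVariable k G) (β : Fin 4 → Fin 4 → Fin 4 → k)
    {i b c d : Fin 4} (hn : [i, b, c, d].Nodup) :
    wordCoeff x i b c d (commSum x (FreeAlgebra.ι k) β i b c d) = β b c d := by
  simp [commSum, longComm_eq_words, wordCoeff_word, ne_of_nodup hn]

end Structure

/-! ### The generic case: a solution space of dimension two. -/

section Generic

variable {k : Type u} {G : Type v} [Field k] [CommGroup G]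
  {x : Fin 4 → QuantumVariable k G} {β β' : Fin 4 → Fin 4 → Fin 4 → k} {i b c d : Fin 4}

theorem LeftRelation.add (h : LeftRelation x β i b c d) (h' : LeftRelation x β' i b c d) :
    LeftRelation x (β + β') i b c d := by
  unfold LeftRelation at *
  simp only [Pi.add_apply]
  linear_combination h + h'

theorem LeftRelation.smul (r : k) (h : LeftRelation x β i b c d) :
    LeftRelation x (r • β) i b c d := by
  unfold LeftRelation at *
  simp only [Pi.smul_apply, smul_eq_mul]
  linear_combination r * h

theorem LeftRelations.add (h : LeftRelations x β i b c d) (h' : LeftRelations x β' i b c d) :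
    LeftRelations x (β + β') i b c d :=
  ⟨⟨h.1.1.add h'.1.1, h.1.2.add h'.1.2⟩, ⟨h.2.1.1.add h'.2.1.1, h.2.1.2.add h'.2.1.2⟩,
    h.2.2.1.add h'.2.2.1, h.2.2.2.add h'.2.2.2⟩

theorem LeftRelations.smul (r : k) (h : LeftRelations x β i b c d) :
    LeftRelations x (r • β) i b c d :=
  ⟨⟨h.1.1.smul r, h.1.2.smul r⟩, ⟨h.2.1.1.smul r, h.2.1.2.smul r⟩, h.2.2.1.smul r, h.2.2.2.smul r⟩

theorem commSum_add {A : Type*} [Ring A] [Algebra k A] (a : Fin 4 → A) :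
    commSum x a (β + β') i b c d = commSum x a β i b c d + commSum x a β' i b c d := by
  simp only [commSum, Pi.add_apply]
  module

theorem commSum_smul {A : Type*} [Ring A] [Algebra k A] (a : Fin 4 → A) (r : k) :
    commSum x a (r • β) i b c d = r • commSum x a β i b c d := by
  simp only [commSum, Pi.smul_apply]
  module

/-- The product `p_{ij} p_{ji}`. -/
def edge (x : Fin 4 → QuantumVariable k G) (i j : Fin 4) : k := (x i).p (x j) * (x j).p (x i)

theorem edge_comm (i j : Fin 4) : edge x i j = edge x j i := mul_comm _ _

theorem totalProd_eq_edge : totalProd x i b c d =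
    edge x i b * edge x i c * edge x i d * edge x b c * edge x b d * edge x c d := rfl

theorem leftRelation_iff_edge : LeftRelation x β i b c d ↔
    (1 - edge x i b) * ((x b).p (x c) * (x b).p (x d)) * β b c d +
      (1 - edge x i b * edge x b c) * (x b).p (x d) * β c b d +
      (1 - edge x i b * edge x b c * edge x b d) * β c d b = 0 := by
  simp only [LeftRelation, edge, mul_comm ((x b).p (x c)) ((x c).p (x b)),
    mul_comm ((x b).p (x d)) ((x d).p (x b))]

/-- The left relations for a letter follow from those for the other two letters, if the total
product is `1`. -/
theorem LeftRelation.of_others (hp : totalProd x i b c d = 1) (hb : edge x i b ≠ 1)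
    (hbcd : LeftRelation x β i b c d) (hbdc : LeftRelation x β i b d c)
    (hdcb : LeftRelation x β i d c b) (hcdb : LeftRelation x β i c d b) :
    LeftRelation x β i c b d := by
  -- This is the coefficient of `β b c d` in the relation `hbcd`; multiplying the goal by it allows
  -- that unknown to be eliminated.
  have hM : (1 - edge x i b) * ((x b).p (x c) * (x b).p (x d)) ≠ 0 :=
    mul_ne_zero (sub_ne_zero.mpr hb.symm)
      (mul_ne_zero (QuantumVariable.p_ne_zero _ _) (QuantumVariable.p_ne_zero _ _))
  unfold LeftRelation at *
  unfold totalProd at hp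
  refine (mul_eq_zero.mp ?_).resolve_left hM
  unfold edge
  linear_combination
    (1 - (x i).p (x c) * (x c).p (x i) * ((x b).p (x c) * (x c).p (x b))) * (x c).p (x d) * hbcd +
    (1 - (x i).p (x c) * (x c).p (x i) * ((x b).p (x c) * (x c).p (x b)) *
      ((x c).p (x d) * (x d).p (x c))) * hbdc +
    (x i).p (x b) * (x b).p (x i) * ((x i).p (x c) * (x c).p (x i)) *
      ((x b).p (x c) * (x c).p (x b)) * (x b).p (x d) * (x c).p (x d) *
      (1 - (x b).p (x c) * (x c).p (x b)) * hdcb -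
    (1 - (x i).p (x b) * (x b).p (x i) * ((x b).p (x d) * (x d).p (x b))) * (x b).p (x c) * hcdb +
    (1 - (x b).p (x c) * (x c).p (x b)) * ((x b).p (x d) * (x c).p (x d) * β c b d +
      (x c).p (x d) * β c d b + β d c b) * hp

/-- The function on triples of letters with the given values on the permutations of `b, c, d`. -/
def sixValues (b c : Fin 4) (v₁ v₂ v₃ v₄ v₅ v₆ : k) : Fin 4 → Fin 4 → Fin 4 → k := fun s t _ =>
  if s = b then if t = c then v₁ else v₂
  else if s = c then if t = b then v₃ else v₄
  else if t = b then v₅ else v₆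

/-- The nonvanishing conditions under which the left relations have a space of solutions of
dimension two. -/
def GenericPair (x : Fin 4 → QuantumVariable k G) (i b c d : Fin 4) : Prop :=
  edge x i b ≠ 1 ∧ edge x i b * edge x i c * edge x b c ≠ 1 ∧
    edge x i b * edge x i d * edge x b d ≠ 1

/-- The star at `d` and the triangle `i, b, c` partition the six edges, so their weights are inverse
to each other. -/
theorem GenericPair.sub_ne_zero₁ (h : GenericPair x i b c d) (hp : totalProd x i b c d = 1) :
    1 - edge x i d * edge x d c * edge x d b ≠ 0 := by
  intro h0
  rw [totalProd_eq_edge] at hp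
  rw [edge_comm d c, edge_comm d b] at h0
  refine h.2.1 ?_
  linear_combination edge x i b * edge x i c * edge x b c * h0 + hp

theorem GenericPair.sub_ne_zero₂ (h : GenericPair x i b c d) (hp : totalProd x i b c d = 1) :
    1 - edge x i c * edge x c d * edge x c b ≠ 0 := by
  intro h0
  rw [totalProd_eq_edge] at hp
  rw [edge_comm c b] at h0
  refine h.2.2 ?_
  linear_combination edge x i b * edge x i d * edge x b d * h0 + hp

/-- The system is triangular in the parameters `β c d b` and `β d c b`: the relations `d c b` and `c
d b` determine `β c b d` and `β d b c`, and then `b c d` and `b d c` determine `β b c d` and `β b d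
c`. The pivots are nonzero by genericity. -/
theorem GenericPair.eq_zero (h : GenericPair x i b c d) (hp : totalProd x i b c d = 1)
    (hβ : LeftRelations x β i b c d) (h₁ : β c d b = 0) (h₂ : β d c b = 0) :
    commSum x (FreeAlgebra.ι k) β i b c d = 0 := by
  have hcbd : β c b d = 0 := by
    have := leftRelation_iff_edge.mp hβ.2.2.2
    rw [h₁, h₂, mul_zero, mul_zero, zero_add, zero_add] at this
    exact (mul_eq_zero.mp this).resolve_left (h.sub_ne_zero₁ hp)
  have hdbc : β d b c = 0 := by
    have := leftRelation_iff_edge.mp hβ.2.1.2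
    rw [h₁, h₂, mul_zero, mul_zero, zero_add, zero_add] at this
    exact (mul_eq_zero.mp this).resolve_left (h.sub_ne_zero₂ hp)
  have h0 : 1 - edge x i b ≠ 0 := sub_ne_zero.mpr h.1.symm
  have hbcd : β b c d = 0 := by
    have := leftRelation_iff_edge.mp hβ.1.1
    rw [h₁, hcbd, mul_zero, mul_zero, add_zero, add_zero] at this
    exact (mul_eq_zero.mp this).resolve_left (mul_ne_zero h0
      (mul_ne_zero (QuantumVariable.p_ne_zero _ _) (QuantumVariable.p_ne_zero _ _)))
  have hbdc : β b d c = 0 := by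
    have := leftRelation_iff_edge.mp hβ.1.2
    rw [h₂, hdbc, mul_zero, mul_zero, add_zero, add_zero] at this
    exact (mul_eq_zero.mp this).resolve_left (mul_ne_zero h0
      (mul_ne_zero (QuantumVariable.p_ne_zero _ _) (QuantumVariable.p_ne_zero _ _)))
  simp [commSum, h₁, h₂, hcbd, hdbc, hbcd, hbdc]

theorem GenericPair.exists_solution (h : GenericPair x i b c d) (hp : totalProd x i b c d = 1)
    (hn : [i, b, c, d].Nodup) (r s : k) :
    ∃ β, LeftRelations x β i b c d ∧ β c d b = r ∧ β d c b = s := by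
  have h0 : 1 - edge x i b ≠ 0 := sub_ne_zero.mpr h.1.symm
  have h1 := h.sub_ne_zero₁ hp
  have h2 := h.sub_ne_zero₂ hp
  have hbc := (x b).p_ne_zero (x c)
  have hbd := (x b).p_ne_zero (x d)
  obtain ⟨v₃, hv₃⟩ : ∃ v, (1 - edge x i d) * ((x d).p (x c) * (x d).p (x b)) * s +
      (1 - edge x i d * edge x d c) * (x d).p (x b) * r +
      (1 - edge x i d * edge x d c * edge x d b) * v = 0 :=
    ⟨-((1 - edge x i d) * ((x d).p (x c) * (x d).p (x b)) * s +
      (1 - edge x i d * edge x d c) * (x d).p (x b) * r) /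
      (1 - edge x i d * edge x d c * edge x d b), by field_simp; ring⟩
  obtain ⟨v₅, hv₅⟩ : ∃ v, (1 - edge x i c) * ((x c).p (x d) * (x c).p (x b)) * r +
      (1 - edge x i c * edge x c d) * (x c).p (x b) * s +
      (1 - edge x i c * edge x c d * edge x c b) * v = 0 :=
    ⟨-((1 - edge x i c) * ((x c).p (x d) * (x c).p (x b)) * r +
      (1 - edge x i c * edge x c d) * (x c).p (x b) * s) /
      (1 - edge x i c * edge x c d * edge x c b), by field_simp; ring⟩
  obtain ⟨v₁, hv₁⟩ : ∃ v, (1 - edge x i b) * ((x b).p (x c) * (x b).p (x d)) * v +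
      (1 - edge x i b * edge x b c) * (x b).p (x d) * v₃ +
      (1 - edge x i b * edge x b c * edge x b d) * r = 0 :=
    ⟨-((1 - edge x i b * edge x b c) * (x b).p (x d) * v₃ +
      (1 - edge x i b * edge x b c * edge x b d) * r) /
      ((1 - edge x i b) * ((x b).p (x c) * (x b).p (x d))), by field_simp; ring⟩
  obtain ⟨v₂, hv₂⟩ : ∃ v, (1 - edge x i b) * ((x b).p (x d) * (x b).p (x c)) * v +
      (1 - edge x i b * edge x b d) * (x b).p (x c) * v₅ +
      (1 - edge x i b * edge x b d * edge x b c) * s = 0 :=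
    ⟨-((1 - edge x i b * edge x b d) * (x b).p (x c) * v₅ +
      (1 - edge x i b * edge x b d * edge x b c) * s) /
      ((1 - edge x i b) * ((x b).p (x d) * (x b).p (x c))), by field_simp; ring⟩
  have ne := ne_of_nodup hn
  refine ⟨sixValues b c v₁ v₂ v₃ r v₅ s, ?_, by simp [sixValues, ne], by simp [sixValues, ne]⟩
  have hbcd : LeftRelation x (sixValues b c v₁ v₂ v₃ r v₅ s) i b c d :=
    leftRelation_iff_edge.mpr (by simpa [sixValues, ne] using hv₁)
  have hbdc : LeftRelation x (sixValues b c v₁ v₂ v₃ r v₅ s) i b d c :=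
    leftRelation_iff_edge.mpr (by simpa [sixValues, ne] using hv₂)
  have hdcb : LeftRelation x (sixValues b c v₁ v₂ v₃ r v₅ s) i d c b :=
    leftRelation_iff_edge.mpr (by simpa [sixValues, ne] using hv₃)
  have hcdb : LeftRelation x (sixValues b c v₁ v₂ v₃ r v₅ s) i c d b :=
    leftRelation_iff_edge.mpr (by simpa [sixValues, ne] using hv₅)
  -- Four relations were solved for the four pivots; the other two are redundant.
  exact ⟨⟨hbcd, hbdc⟩, ⟨.of_others hp h.1 hbcd hbdc hdcb hcdb, hcdb⟩,
    .of_others ((totalProd_swap₂ ..).trans hp) h.1 hbdc hbcd hcdb hdcb, hdcb⟩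

theorem GenericPair.exists_basis (h : GenericPair x i b c d) (hp : totalProd x i b c d = 1)
    (hn : [i, b, c, d].Nodup) : ∃ W₁ W₂ : FreeAlgebra k (Fin 4), LinearIndependent k ![W₁, W₂] ∧
      ∀ W, IsMultilinearOperation x W ↔ ∃ r s : k, W = r • W₁ + s • W₂ := by
  obtain ⟨β₁, h₁, hr₁, hs₁⟩ := h.exists_solution hp hn 1 0
  obtain ⟨β₂, h₂, hr₂, hs₂⟩ := h.exists_solution hp hn 0 1
  refine ⟨commSum x (FreeAlgebra.ι k) β₁ i b c d, commSum x (FreeAlgebra.ι k) β₂ i b c d, ?_,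
    fun W => ⟨fun hW => ?_, ?_⟩⟩
  · rw [LinearIndependent.pair_iff]
    intro r s hrs
    rw [← commSum_smul, ← commSum_smul, ← commSum_add] at hrs
    have h4 := congrArg (wordCoeff x i c d b) hrs
    have h6 := congrArg (wordCoeff x i d c b) hrs
    simp [commSum, longComm_eq_words, wordCoeff_word, ne_of_nodup hn, hr₁, hr₂] at h4
    simp [commSum, longComm_eq_words, wordCoeff_word, ne_of_nodup hn, hs₁, hs₂] at h6
    exact ⟨h4, h6⟩
  · obtain ⟨β, rfl, hβ, -⟩ := hW.exists_commSum hn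
    refine ⟨β c d b, β d c b, ?_⟩
    -- The difference between `β` and the proposed combination solves the relations with both
    -- parameters zero.
    have := h.eq_zero hp (hβ.add (((h₁.smul (β c d b)).add (h₂.smul (β d c b))).smul (-1)))
      (by simp [hr₁, hr₂]) (by simp [hs₁, hs₂])
    rw [commSum_add, commSum_smul, commSum_add, commSum_smul, commSum_smul, neg_one_smul,
      ← sub_eq_add_neg, sub_eq_zero] at this
    exact this
  · rintro ⟨r, s, rfl⟩
    rw [← commSum_smul, ← commSum_smul, ← commSum_add]
    exact ⟨isMultilinear_commSum x _ hn,
      isQuantumOperation_commSum hp ((h₁.smul r).add (h₂.smul s))⟩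

end Generic

/-! ### Exceptional configurations: nonzero operations and their decomposition. -/

section Special

variable {k : Type u} {G : Type v} [Field k] [CommGroup G]
  {x : Fin 4 → QuantumVariable k G} {β : Fin 4 → Fin 4 → Fin 4 → k} {i b c d : Fin 4}

theorem QuantumVariable.mul_p (y z t : QuantumVariable k G) : (y * z).p t = y.p t * z.p t :=
  Units.val_mul _ _

theorem QuantumVariable.p_mul (y z t : QuantumVariable k G) : t.p (y * z) = t.p y * t.p z :=
  (congrArg Units.val (map_mul t.chi y.g z.g)).trans (Units.val_mul _ _)

/-- The variable `x_i` has trivial braiding with the other three, which form a triangle with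
trivial total product. -/
def IsolatedVertex (x : Fin 4 → QuantumVariable k G) (i b c d : Fin 4) : Prop :=
  (edge x i b = 1 ∧ edge x i c = 1 ∧ edge x i d = 1) ∧
    (edge x b c ≠ 1 ∧ edge x b d ≠ 1 ∧ edge x c d ≠ 1) ∧ edge x b c * edge x b d * edge x c d = 1

/-- Two opposite edges are trivial, and so are the products of the edges from the vertices of the
second one to the first one. -/
def OppositeTrivial (x : Fin 4 → QuantumVariable k G) (i b c d : Fin 4) : Prop :=
  (edge x i b = 1 ∧ edge x c d = 1) ∧ edge x i c * edge x b c = 1 ∧ edge x i d * edge x b d = 1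

/-- Opposite edges agree and are nontrivial, and triangles are trivial. -/
def OppositeEqual (x : Fin 4 → QuantumVariable k G) (i b c d : Fin 4) : Prop :=
  (edge x c d = edge x i b ∧ edge x b d = edge x i c ∧ edge x b c = edge x i d) ∧
    (edge x i b ≠ 1 ∧ edge x i c ≠ 1 ∧ edge x i d ≠ 1) ∧ edge x i b * edge x i c * edge x i d = 1

section Existence

theorem commSum_ne_zero (hn : [i, b, c, d].Nodup) (h : β b c d ≠ 0) :
    commSum x (FreeAlgebra.ι k) β i b c d ≠ 0 := by
  intro h0
  rw [← wordCoeff_commSum x β hn, h0, map_zero] at h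
  exact h rfl

theorem exists_operation_of_leftRelations (hp : totalProd x i b c d = 1)
    (hn : [i, b, c, d].Nodup) (hβ : LeftRelations x β i b c d) (h : β b c d ≠ 0) :
    ∃ W, W ≠ 0 ∧ IsMultilinearOperation x W :=
  ⟨_, commSum_ne_zero hn h, isMultilinear_commSum x β hn, isQuantumOperation_commSum hp hβ⟩

theorem IsolatedVertex.exists_operation (h : IsolatedVertex x i b c d)
    (hp : totalProd x i b c d = 1) (hn : [i, b, c, d].Nodup) :
    ∃ W, W ≠ 0 ∧ IsMultilinearOperation x W := by
  obtain ⟨⟨h₁, h₂, h₃⟩, ⟨-, h₄, -⟩, h₅⟩ := h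
  have ne := ne_of_nodup hn
  -- Only the commutators headed by `[x_i, x_b]` are used. The two values solve the relation `c b
  -- d`, and the triangle condition makes the relation `d b c` proportional to it.
  refine exists_operation_of_leftRelations hp hn (β := sixValues b c (1 - edge x b c * edge x c d)
    (-((1 - edge x b c) * (x c).p (x d))) 0 0 0 0) ?_ ?_
  · simp only [LeftRelations, leftRelation_iff_edge]
    simp only [sixValues, ne, h₁, h₂, h₃, if_true, if_false, mul_zero, add_zero,
      sub_self, zero_mul, one_mul, edge_comm c b, edge_comm d b, edge_comm d c, true_and, and_true,
      zero_add]
    refine ⟨by ring, ?_⟩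
    unfold edge at *
    linear_combination ((x d).p (x c) * (x c).p (x d) - 1) * h₅
  · simp only [sixValues, if_true]
    intro h0
    exact h₄ (by linear_combination edge x b d * h0 + h₅)

theorem OppositeTrivial.exists_operation (h : OppositeTrivial x i b c d)
    (hp : totalProd x i b c d = 1) (hn : [i, b, c, d].Nodup) :
    ∃ W, W ≠ 0 ∧ IsMultilinearOperation x W := by
  obtain ⟨⟨h₁, h₂⟩, h₃, h₄⟩ := h
  have ne := ne_of_nodup hn
  refine exists_operation_of_leftRelations hp hn (β := sixValues b c 1 0 0 0 0 0) ?_ ?_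
  · simp only [LeftRelations, leftRelation_iff_edge]
    simp [sixValues, ne, h₁, h₂, h₃, h₄, edge_comm c b, edge_comm d b, edge_comm d c]
  · simp [sixValues]

theorem OppositeEqual.exists_operation (h : OppositeEqual x i b c d)
    (hp : totalProd x i b c d = 1) (hn : [i, b, c, d].Nodup) :
    ∃ W, W ≠ 0 ∧ IsMultilinearOperation x W := by
  obtain ⟨⟨h₁, h₂, h₃⟩, ⟨-, h₄, -⟩, h₅⟩ := h
  have ne := ne_of_nodup hn
  have h₅' : edge x i b * edge x i d * edge x i c = 1 := by rw [← h₅]; ring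
  have h₅'' : edge x i c * edge x i d * edge x i b = 1 := by rw [← h₅]; ring
  have h₅₃ : edge x i d * edge x i b * edge x i c = 1 := by rw [← h₅]; ring
  have h₅₄ : edge x i d * edge x i c * edge x i b = 1 := by rw [← h₅]; ring
  -- Only the commutators ending in `x_d` are used; the two nonzero values solve the relation `b c
  -- d`.
  refine exists_operation_of_leftRelations hp hn
    (β := sixValues b c (1 - edge x i b * edge x i d) 0
      (-((1 - edge x i b) * (x b).p (x c))) 0 0 0) ?_ ?_
  · simp only [LeftRelations, leftRelation_iff_edge]
    simp only [sixValues, ne, h₁, h₂, h₃, h₅, h₅', h₅'', h₅₃, h₅₄, if_true, if_false, mul_zero,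
      add_zero, sub_self, zero_mul, edge_comm c b, edge_comm d b, edge_comm d c, and_true]
    refine ⟨by ring, ?_⟩
    rw [edge] at h₃
    linear_combination (x c).p (x d) * (edge x i d - 1) * h₅ -
      (x c).p (x d) * (1 - edge x i b) * (1 - edge x i c) * h₃
  · simp only [sixValues, if_true]
    intro h0
    exact h₄ (by linear_combination edge x i c * h0 + h₅)

end Existence

section Superpositions

theorem IsSuperposition.longComm (h₁ : edge x i b = 1) (h₂ : edge x i c * edge x b c = 1)
    (h₃ : edge x i d * edge x b d * edge x c d = 1) :
    ∃ y, IsSuperposition x (longComm x (FreeAlgebra.ι k) i b c d) y := by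
  have := (((IsSuperposition.var (x := x) i).bilinear (.var b) h₁).bilinear (.var c) (by
    rw [MainBilinearDefined, QuantumVariable.mul_p, QuantumVariable.p_mul, ← h₂]
    unfold edge; ring)).bilinear (.var d) (by
    simp only [MainBilinearDefined, QuantumVariable.mul_p, QuantumVariable.p_mul, ← h₃]
    unfold edge; ring)
  simp only [mainBilinear, QuantumVariable.mul_p] at this
  exact ⟨_, this⟩

/-- The superposition is `[[x_i, [x_c, x_d]], x_b]`. A skew Jacobi identity rewrites it in long
commutators, with an error divisible by `p_{cd} p_{dc} - 1`. -/
theorem IsSuperposition.longComm_inner (h₁ : edge x c d = 1) (h₂ : edge x i c * edge x i d = 1)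
    (h₃ : edge x i b * edge x b c * edge x b d = 1) :
    ∃ y, IsSuperposition x (_root_.longComm x (FreeAlgebra.ι k) i c d b -
      (x c).p (x d) • _root_.longComm x (FreeAlgebra.ι k) i d c b) y := by
  have := ((IsSuperposition.var (x := x) i).bilinear
    ((IsSuperposition.var (x := x) c).bilinear (.var d) h₁) (by
      simp only [MainBilinearDefined, QuantumVariable.mul_p, QuantumVariable.p_mul, ← h₂]
      unfold edge; ring)).bilinear (.var b) (by
      simp only [MainBilinearDefined, QuantumVariable.mul_p, QuantumVariable.p_mul, ← h₃]
      unfold edge; ring)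
  refine ⟨_, (congrArg (fun P => IsSuperposition x P _) ?_).mpr this⟩
  unfold edge at h₁
  simp only [longComm_eq_words, mainBilinear, skewComm, word, QuantumVariable.mul_p,
    QuantumVariable.p_mul, mul_sub, sub_mul, smul_mul_assoc, mul_smul_comm, mul_assoc]
  set I := FreeAlgebra.ι k i
  set B := FreeAlgebra.ι k b
  set C := FreeAlgebra.ι k c
  set D := FreeAlgebra.ι k d
  linear_combination (norm := module)
    h₁ • ((x i).p (x c) • (C * (I * (D * B)) - (x i).p (x d) • (C * (D * (I * B))) -
      ((x i).p (x b) * (x c).p (x b) * (x d).p (x b)) •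
        (B * (C * (I * D)) - (x i).p (x d) • (B * (C * (D * I))))))

/-- The coefficient in the main trilinear operation. -/
theorem mainTrilinear_coeff {y z t : QuantumVariable k G}
    (h : y.p z * z.p y * (y.p t * t.p y) * (z.p t * t.p z) = 1) (hyt : y.p t * t.p y ≠ 1) :
    ((t.p y)⁻¹ * (t.p z)⁻¹ - y.p t * z.p t) / ((t.p y)⁻¹ - y.p t) *
      (1 - y.p z * z.p y * (z.p t * t.p z)) = (1 - y.p z * z.p y) * z.p t := by
  have hT := t.p_ne_zero y
  have hZ := t.p_ne_zero z
  have hu := mul_inv_cancel₀ hT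
  have hw := mul_inv_cancel₀ hZ
  have h0 : (t.p y)⁻¹ - y.p t ≠ 0 := by
    intro h0
    exact hyt (by linear_combination hu - t.p y * h0)
  rw [div_mul_eq_mul_div, div_eq_iff h0]
  refine mul_left_cancel₀ (mul_ne_zero hT hZ) ?_
  linear_combination (1 - y.p z * z.p y * (z.p t * t.p z)) * (t.p z * (t.p z)⁻¹ * hu + hw) -
    t.p z * (1 - y.p z * z.p y) * z.p t * hu + (z.p t * t.p z - 1) * h

theorem eq_neg_coeff_mul {r u v s s' : k} (hu : u ≠ 0) (hr : r * u = v) (h : v * s + u * s' = 0) :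
    s' = -(r * s) := by
  refine mul_left_cancel₀ hu ?_
  linear_combination h + s * hr

/-- The superposition takes the main trilinear operation of `x_i, x_b, x_c` and then the commutator
with `x_d`. By `h₃` the third term of the left relation disappears, and the remaining ratio of
coefficients is the one in the trilinear operation. -/
theorem IsSuperposition.longComm_triangle (h₁ : edge x i b * edge x i c * edge x b c = 1)
    (hib : edge x i b ≠ 1) (hic : edge x i c ≠ 1) (hbc : edge x b c ≠ 1)
    (h₂ : edge x i d * edge x b d * edge x c d = 1) (h₃ : edge x i b * edge x b c * edge x b d = 1)
    (hβ : LeftRelation x β i b c d) :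
    ∃ P y, IsSuperposition x P y ∧
      β b c d • _root_.longComm x (FreeAlgebra.ι k) i b c d +
        β c b d • _root_.longComm x (FreeAlgebra.ι k) i c b d = β b c d • P := by
  have := (((IsSuperposition.var (x := x) i).trilinear (.var b) (.var c)
    ⟨h₁, hib, hic, hbc⟩)).bilinear (.var d) (by
      simp only [MainBilinearDefined, QuantumVariable.mul_p, QuantumVariable.p_mul, ← h₂]
      unfold edge; ring)
  refine ⟨_, _, this, ?_⟩
  have hκ := mainTrilinear_coeff (y := x i) (z := x b) (t := x c) h₁ hic
  have h0 : 1 - edge x i b * edge x b c ≠ 0 := by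
    intro h0
    exact hic (by linear_combination edge x i c * h0 + h₁)
  rw [leftRelation_iff_edge, h₃, sub_self, zero_mul, add_zero] at hβ
  rw [eq_neg_coeff_mul h0 hκ (s := β b c d) (s' := β c b d) (mul_left_cancel₀
    ((x b).p_ne_zero (x d)) (by unfold edge at *; linear_combination hβ))]
  simp only [mainBilinear, mainTrilinear, _root_.longComm, tripleComm, QuantumVariable.mul_p]
  simp only [skewComm, mul_sub, sub_mul, smul_mul_assoc, mul_smul_comm]
  module

/-- The superposition is the main trilinear operation of `[x_i, x_b]`, `x_c`, `x_d`: since `e_{ic} =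
e_{id} = 1`, the inner bracket has the same edge weights with `x_c` and `x_d` as `x_b` alone. -/
theorem IsSuperposition.longComm_pair (h₁ : edge x i b = 1) (hic : edge x i c = 1)
    (hid : edge x i d = 1) (h : edge x b c * edge x b d * edge x c d = 1)
    (hbc : edge x b c ≠ 1) (hbd : edge x b d ≠ 1) (hcd : edge x c d ≠ 1)
    (hβ : LeftRelation x β i c b d) :
    ∃ P y, IsSuperposition x P y ∧
      β b c d • _root_.longComm x (FreeAlgebra.ι k) i b c d +
        β b d c • _root_.longComm x (FreeAlgebra.ι k) i b d c = β b c d • P := by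
  have ec : (x i * x b).p (x c) * (x c).p (x i * x b) = edge x b c := by
    rw [QuantumVariable.mul_p, QuantumVariable.p_mul]
    unfold edge at *; linear_combination (x b).p (x c) * (x c).p (x b) * hic
  have ed : (x i * x b).p (x d) * (x d).p (x i * x b) = edge x b d := by
    rw [QuantumVariable.mul_p, QuantumVariable.p_mul]
    unfold edge at *; linear_combination (x b).p (x d) * (x d).p (x b) * hid
  have h' : (x i * x b).p (x c) * (x c).p (x i * x b) *
      ((x i * x b).p (x d) * (x d).p (x i * x b)) * ((x c).p (x d) * (x d).p (x c)) = 1 := by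
    rw [ec, ed]; exact h
  have := ((IsSuperposition.var (x := x) i).bilinear (.var b) h₁).trilinear (.var c) (.var d)
    ⟨h', by rwa [ec], by rwa [ed], hcd⟩
  refine ⟨_, _, this, ?_⟩
  have hκ := mainTrilinear_coeff h' (by rwa [ed])
  rw [ec] at hκ
  have h0 : 1 - edge x b c * edge x c d ≠ 0 := by
    intro h0
    exact hbd (by linear_combination edge x b d * h0 + h)
  rw [leftRelation_iff_edge, hic, sub_self, zero_mul, zero_mul, zero_add, one_mul,
    edge_comm c b] at hβ
  rw [eq_neg_coeff_mul h0 hκ (s := β b c d) (s' := β b d c) hβ]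
  simp only [mainBilinear, mainTrilinear, _root_.longComm, tripleComm, QuantumVariable.mul_p,
    mul_assoc]
  module

end Superpositions

section Span

theorem IsSuperposition.smul_mem_span {P : FreeAlgebra k (Fin 4)} {y : QuantumVariable k G}
    (h : IsSuperposition x P y) (hP : IsMultilinear P) (r : k) :
    r • P ∈ Submodule.span k (multilinearSuperpositions x) :=
  Submodule.smul_mem _ _ (Submodule.subset_span ⟨hP, y, h⟩)

/-- Multilinearity of `P` need not be checked directly: it is inherited from `W` when `r` is
invertible, and irrelevant when `r = 0`. -/
theorem exists_superposition_smul_mem_span {r : k} {W : FreeAlgebra k (Fin 4)}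
    (hW : IsMultilinear W) (h : ∃ P y, IsSuperposition x P y ∧ W = r • P) :
    W ∈ Submodule.span k (multilinearSuperpositions x) := by
  obtain ⟨P, y, hP, rfl⟩ := h
  rcases eq_or_ne r 0 with rfl | hr
  · simp
  · refine hP.smul_mem_span ?_ r
    have := hW.smul r⁻¹
    rwa [smul_smul, inv_mul_cancel₀ hr, one_smul] at this

theorem isMultilinear_pair (r s : k) {b' c' d' : Fin 4} (hn : [i, b, c, d].Nodup)
    (hn' : [i, b', c', d'].Nodup) :
    IsMultilinear (r • longComm x (FreeAlgebra.ι k) i b c d +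
      s • longComm x (FreeAlgebra.ι k) i b' c' d') :=
  ((isMultilinear_longComm x hn).smul r).add ((isMultilinear_longComm x hn').smul s)

theorem IsolatedVertex.mem_span (h : IsolatedVertex x i b c d) (hn : [i, b, c, d].Nodup)
    (hβ : LeftRelations x β i b c d) :
    commSum x (FreeAlgebra.ι k) β i b c d ∈ Submodule.span k (multilinearSuperpositions x) := by
  obtain ⟨⟨hib, hic, hid⟩, ⟨hbc, hbd, hcd⟩, h⟩ := h
  obtain ⟨n₁, n₂, n₃, n₄, n₅⟩ := nodup_perms hn
  obtain ⟨⟨h₁, h₂⟩, ⟨h₃, h₄⟩, h₅, h₆⟩ := hβ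
  -- The commutators are paired by their second letter, to which `x_i` is joined by a trivial edge.
  have e : commSum x (FreeAlgebra.ι k) β i b c d =
      (β b c d • longComm x (FreeAlgebra.ι k) i b c d +
        β b d c • longComm x (FreeAlgebra.ι k) i b d c) +
      (β c b d • longComm x (FreeAlgebra.ι k) i c b d +
        β c d b • longComm x (FreeAlgebra.ι k) i c d b) +
      (β d b c • longComm x (FreeAlgebra.ι k) i d b c +
        β d c b • longComm x (FreeAlgebra.ι k) i d c b) := by
    rw [commSum]; abel
  rw [e]
  refine add_mem (add_mem ?_ ?_) ?_
  · exact exists_superposition_smul_mem_span (isMultilinear_pair _ _ hn n₁)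
      (IsSuperposition.longComm_pair hib hic hid h hbc hbd hcd h₃)
  · refine exists_superposition_smul_mem_span (isMultilinear_pair _ _ n₂ n₃)
      (IsSuperposition.longComm_pair hic hib hid ?_ ?_ hcd hbd h₁)
    · rw [edge_comm c b, ← h]; ring
    · rwa [edge_comm]
  · refine exists_superposition_smul_mem_span (isMultilinear_pair _ _ n₄ n₅)
      (IsSuperposition.longComm_pair hid hib hic ?_ ?_ ?_ hbc h₂)
    · rw [edge_comm d b, edge_comm d c, ← h]; ring
    · rwa [edge_comm]
    · rwa [edge_comm]

theorem OppositeEqual.mem_span (h : OppositeEqual x i b c d) (hn : [i, b, c, d].Nodup)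
    (hβ : LeftRelations x β i b c d) :
    commSum x (FreeAlgebra.ι k) β i b c d ∈ Submodule.span k (multilinearSuperpositions x) := by
  obtain ⟨⟨ecd, ebd, ebc⟩, ⟨hb, hc, hd⟩, h⟩ := h
  obtain ⟨n₁, n₂, n₃, n₄, n₅⟩ := nodup_perms hn
  obtain ⟨⟨h₁, h₂⟩, ⟨h₃, h₄⟩, h₅, h₆⟩ := hβ
  -- The commutators are paired by their last letter; the other three letters form a trivial
  -- triangle.
  have e : commSum x (FreeAlgebra.ι k) β i b c d =
      (β b c d • longComm x (FreeAlgebra.ι k) i b c d +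
        β c b d • longComm x (FreeAlgebra.ι k) i c b d) +
      (β b d c • longComm x (FreeAlgebra.ι k) i b d c +
        β d b c • longComm x (FreeAlgebra.ι k) i d b c) +
      (β c d b • longComm x (FreeAlgebra.ι k) i c d b +
        β d c b • longComm x (FreeAlgebra.ι k) i d c b) := by
    rw [commSum]; abel
  rw [e]
  refine add_mem (add_mem ?_ ?_) ?_
  · refine exists_superposition_smul_mem_span (isMultilinear_pair _ _ hn n₂)
      (IsSuperposition.longComm_triangle ?_ hb hc ?_ ?_ ?_ h₁) <;>
    simp only [ecd, ebd, ebc] <;> first | assumption | (rw [← h]; ring)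
  · refine exists_superposition_smul_mem_span (isMultilinear_pair _ _ n₁ n₄)
      (IsSuperposition.longComm_triangle ?_ hb hd ?_ ?_ ?_ h₂) <;>
    simp only [edge_comm d c, ecd, ebd, ebc] <;> first | assumption | (rw [← h]; ring)
  · refine exists_superposition_smul_mem_span (isMultilinear_pair _ _ n₃ n₅)
      (IsSuperposition.longComm_triangle ?_ hc hd ?_ ?_ ?_ h₄) <;>
    simp only [edge_comm d b, edge_comm c b, ecd, ebd, ebc] <;>
    first | assumption | (rw [← h]; ring)

theorem OppositeTrivial.mem_span (h : OppositeTrivial x i b c d) (hn : [i, b, c, d].Nodup)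
    (hβ : LeftRelations x β i b c d) :
    commSum x (FreeAlgebra.ι k) β i b c d ∈ Submodule.span k (multilinearSuperpositions x) := by
  obtain ⟨⟨hib, hcd⟩, hbc, hbd⟩ := h
  obtain ⟨n₁, n₂, n₃, n₄, n₅⟩ := nodup_perms hn
  obtain ⟨⟨h₁, h₂⟩, ⟨h₃, h₄⟩, h₅, h₆⟩ := hβ
  have mem : ∀ {b c d : Fin 4} (r : k), [i, b, c, d].Nodup → edge x i b = 1 →
      edge x i c * edge x b c = 1 → edge x i d * edge x b d * edge x c d = 1 →
      r • longComm x (FreeAlgebra.ι k) i b c d ∈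
        Submodule.span k (multilinearSuperpositions x) := fun r hn e₁ e₂ e₃ => by
    obtain ⟨y, hy⟩ := IsSuperposition.longComm (x := x) e₁ e₂ e₃
    exact hy.smul_mem_span (isMultilinear_longComm x hn) r
  -- This serves the commutators with the distinguished letter in the middle: either the coefficient
  -- vanishes or the edge to the second letter is also trivial, and bilinear operations suffice.
  have mem_or : ∀ {b c d : Fin 4} (r : k), [i, b, c, d].Nodup → edge x i c = 1 →
      edge x i d * edge x c d * edge x b d = 1 → edge x i b * edge x b c = 1 →
      (1 - edge x i b) * r = 0 →
      r • longComm x (FreeAlgebra.ι k) i b c d ∈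
        Submodule.span k (multilinearSuperpositions x) := fun {b c d} r hn e₁ e₂ e₃ e₄ => by
    rcases mul_eq_zero.mp e₄ with e | rfl
    · have e' : edge x i b = 1 := (sub_eq_zero.mp e).symm
      refine mem r hn e' ?_ ?_
      · rw [e₁, one_mul, ← e₃, e', one_mul]
      · rw [← e₂]; ring
    · simp
  have hdc : edge x d c = 1 := (edge_comm d c).trans hcd
  have e : commSum x (FreeAlgebra.ι k) β i b c d =
      β b c d • longComm x (FreeAlgebra.ι k) i b c d +
        β b d c • longComm x (FreeAlgebra.ι k) i b d c +
      β c b d • longComm x (FreeAlgebra.ι k) i c b d +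
        β d b c • longComm x (FreeAlgebra.ι k) i d b c +
      (β c d b • longComm x (FreeAlgebra.ι k) i c d b +
        β d c b • longComm x (FreeAlgebra.ι k) i d c b) := by
    rw [commSum]; abel
  rw [leftRelation_iff_edge] at h₁ h₃ h₄ h₅ h₆
  simp only [edge_comm c b, edge_comm d b, hdc, hcd, hbc, hbd, hib, mul_one, one_mul,
    sub_self, zero_mul, add_zero, zero_add] at h₁ h₃ h₄ h₅ h₆
  have h₃' : (1 - edge x i c) * β c b d = 0 := by
    refine mul_left_cancel₀ (mul_ne_zero ((x c).p_ne_zero (x b)) ((x c).p_ne_zero (x d))) ?_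
    linear_combination h₃
  have h₅' : (1 - edge x i d) * β d b c = 0 := by
    refine mul_left_cancel₀ (mul_ne_zero ((x d).p_ne_zero (x b)) ((x d).p_ne_zero (x c))) ?_
    linear_combination h₅
  rw [e]
  refine add_mem (add_mem (add_mem (add_mem (mem _ hn hib hbc ?_) (mem _ n₁ hib hbd ?_))
    (mem_or _ n₂ hib ?_ ?_ h₃')) (mem_or _ n₄ hib ?_ ?_ h₅')) ?_
  · rw [hcd, hbd, mul_one]
  · rw [hdc, hbc, mul_one]
  · rw [hcd, mul_one, hbd]
  · rw [edge_comm c b, hbc]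
  · rw [hdc, mul_one, hbc]
  · rw [edge_comm d b, hbd]
  -- The two commutators ending in `x_b` remain. If both edges are trivial, all six are, and each
  -- commutator is a superposition of bilinear operations.
  by_cases hall : edge x i c = 1 ∧ edge x i d = 1
  · obtain ⟨hic, hid⟩ := hall
    rw [hic, one_mul] at hbc
    rw [hid, one_mul] at hbd
    refine add_mem (mem _ n₃ hic ?_ ?_) (mem _ n₅ hid ?_ ?_) <;>
      simp [hic, hid, hib, hcd, hdc, hbc, hbd, edge_comm c b, edge_comm d b]
  have hrel : (x c).p (x d) * β c d b + β d c b = 0 := by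
    rw [not_and_or] at hall
    rcases hall with hic | hid
    · refine (mul_eq_zero.mp ?_).resolve_left
        (mul_ne_zero (sub_ne_zero.mpr (Ne.symm hic)) ((x c).p_ne_zero (x b)))
      linear_combination h₄
    · refine (mul_eq_zero.mp ?_).resolve_left (mul_ne_zero (sub_ne_zero.mpr (Ne.symm hid))
        (mul_ne_zero ((x d).p_ne_zero (x c)) ((x d).p_ne_zero (x b))))
      unfold edge at *
      linear_combination h₆ + (1 - (x i).p (x d) * (x d).p (x i)) * (x d).p (x b) * β c d b * hcd
  have hdcb : β d c b = -((x c).p (x d) * β c d b) := by linear_combination hrel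
  -- By `hrel` the two commutators occur in the ratio that forms `[[x_i, [x_c, x_d]], x_b]`. It is
  -- defined if this product is 1; otherwise the relation `b c d` makes the coefficient vanish.
  by_cases hcd' : edge x i c * edge x i d = 1
  · obtain ⟨y, hy⟩ := IsSuperposition.longComm_inner (b := b) hcd hcd' (by
      rw [hib, one_mul]
      linear_combination edge x i d * edge x b d * hbc + hbd -
        edge x b c * edge x b d * hcd')
    have := hy.smul_mem_span (((isMultilinear_longComm x n₃)).sub
      ((isMultilinear_longComm x n₅).smul _)) (β c d b)
    rw [hdcb]
    convert this using 1
    module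
  · have h0 : 1 - edge x b c * edge x b d ≠ 0 := by
      intro h0
      refine hcd' ?_
      linear_combination edge x i c * edge x i d * h0 + edge x i d * edge x b d * hbc + hbd
    have hcdb : β c d b = 0 := by
      refine (mul_eq_zero.mp ?_).resolve_left h0
      linear_combination h₁ + (x b).p (x d) * edge x b c * h₃' + (x b).p (x d) * β c b d * hbc
    rw [hdcb, hcdb]
    simp

end Span

end Special

/-! ### Edge weights of the complete graph on four vertices, and the classification when `Γ₄` fails
everywhere. -/

section Classification

variable {k : Type u} {G : Type v} [Field k] [CommGroup G]
  {x : Fin 4 → QuantumVariable k G} {i b c d : Fin 4}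

theorem prod_offDiag_eq (hn : [i, b, c, d].Nodup) :
    ∏ e ∈ (Finset.univ : Finset (Fin 4)).offDiag, (x e.1).p (x e.2) = totalProd x i b c d := by
  obtain ⟨e, rfl, rfl, rfl, rfl⟩ := exists_perm_of_nodup hn
  have h : (Finset.univ : Finset (Fin 4)).offDiag = Finset.univ.filter fun t => t.1 ≠ t.2 := by
    ext; simp
  rw [h, Finset.prod_filter, ← Fintype.prod_equiv (e.prodCongr e) (fun t =>
    if t.1 ≠ t.2 then (x (e t.1)).p (x (e t.2)) else 1) _ (fun t => by simp),
    Fintype.prod_prod_type]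
  simp [Fin.prod_univ_four, totalProd]
  ring

theorem eq_or_eq_of_nodup (hn : [i, b, c, d].Nodup) (t : Fin 4) :
    t = i ∨ t = b ∨ t = c ∨ t = d := by
  obtain ⟨e, rfl, rfl, rfl, rfl⟩ := exists_perm_of_nodup hn
  obtain ⟨j, rfl⟩ := e.surjective t
  fin_cases j <;> simp

theorem brace_single_ne_zero_iff (i j : Fin 4) : brace x [(i, j)] ≠ 0 ↔ edge x i j ≠ 1 := by
  have h := (x j).p_ne_zero (x i)
  simp only [brace, List.map_cons, List.map_nil, List.prod_cons, List.prod_nil, mul_one, ne_eq,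
    sub_eq_zero, edge, ← mul_eq_one_iff_eq_inv₀ h]

theorem brace_triple_ne_zero_iff (i j l : Fin 4) :
    brace x [(i, j), (i, l), (l, j)] ≠ 0 ↔ edge x i j * edge x i l * edge x j l ≠ 1 := by
  have h := mul_ne_zero ((x j).p_ne_zero (x i))
    (mul_ne_zero ((x l).p_ne_zero (x i)) ((x j).p_ne_zero (x l)))
  simp only [brace, List.map_cons, List.map_nil, List.prod_cons, List.prod_nil, mul_one, ne_eq,
    sub_eq_zero, ← mul_inv, ← mul_eq_one_iff_eq_inv₀ h]
  unfold edge
  ring_nf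

theorem gamma4_iff (hn : [i, b, c, d].Nodup) : Gamma4 x i b ↔ GenericPair x i b c d := by
  have ne := ne_of_nodup hn
  refine and_congr (brace_single_ne_zero_iff i b) ?_
  simp only [brace_triple_ne_zero_iff]
  constructor
  · intro h
    exact ⟨h c ne.2.2.1 ne.2.2.2.2.1, h d ne.2.2.2.1 ne.2.2.2.2.2.1⟩
  · rintro ⟨h₁, h₂⟩ l hli hlb
    rcases eq_or_eq_of_nodup hn l with h | h | rfl | rfl
    · exact absurd h hli
    · exact absurd h hlb
    · exact h₁
    · exact h₂

/-- The product of the edges at a vertex. -/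
def starProd (x : Fin 4 → QuantumVariable k G) (v : Fin 4) : k :=
  ∏ w ∈ Finset.univ.erase v, edge x v w

theorem starProd_eq (hn : [i, b, c, d].Nodup) :
    starProd x i = edge x i b * edge x i c * edge x i d := by
  have ne := ne_of_nodup hn
  have h : Finset.univ.erase i = {b, c, d} := by
    ext t
    rcases eq_or_eq_of_nodup hn t with rfl | rfl | rfl | rfl <;> simp [ne]
  rw [starProd, h, Finset.prod_insert (by simp [ne]), Finset.prod_insert (by simp [ne]),
    Finset.prod_singleton, mul_assoc]

/-- The exceptional configurations of the products `p_{ij} p_{ji}`. -/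
def Exceptional (x : Fin 4 → QuantumVariable k G) : Prop :=
  ∃ i b c d, [i, b, c, d].Nodup ∧
    (IsolatedVertex x i b c d ∨ OppositeTrivial x i b c d ∨ OppositeEqual x i b c d)

/-- Nontrivial stars at `i` and `b` mean nontrivial triangles `b, c, d` and `i, c, d`, the two
through the edge `c, d`. Failure of `Γ₄` on that edge leaves only the edge itself to be trivial. -/
theorem edge_eq_one_of_starProd_ne_one (hΓ : ∀ i j, i ≠ j → ¬ Gamma4 x i j)
    (hp : totalProd x i b c d = 1) (hn : [i, b, c, d].Nodup)
    (hi : starProd x i ≠ 1) (hb : starProd x b ≠ 1) : edge x c d = 1 := by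
  by_contra h
  have ne := ne_of_nodup hn
  rw [starProd_eq hn] at hi
  rw [starProd_eq (i := b) (b := i) (c := c) (d := d) (by simp [ne])] at hb
  rw [totalProd_eq_edge] at hp
  refine hΓ c d ne.1.2.2.2.2.2 ((gamma4_iff (c := i) (d := b) (by simp [ne])).mpr
    ⟨h, fun h' => hb ?_, fun h' => hi ?_⟩)
  · rw [edge_comm c i, edge_comm d i] at h'
    rw [edge_comm b i]
    linear_combination hp - edge x i b * edge x b c * edge x b d * h'
  · rw [edge_comm c b, edge_comm d b] at h'
    linear_combination hp - edge x i b * edge x i c * edge x i d * h'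

/-- All triangles are trivial too, and comparing the star at `i` with the triangles through `i`
shows that opposite edges agree. A trivial edge then gives `OppositeTrivial`; otherwise
`OppositeEqual` holds. -/
theorem exceptional_of_starProd_eq_one (hp : totalProd x i b c d = 1) (hn : [i, b, c, d].Nodup)
    (hi : starProd x i = 1) (hb : starProd x b = 1) (hc : starProd x c = 1)
    (hd : starProd x d = 1) : Exceptional x := by
  have ne := ne_of_nodup hn
  rw [starProd_eq hn] at hi
  rw [starProd_eq (i := b) (b := i) (c := c) (d := d) (by simp [ne]), edge_comm b i] at hb
  rw [starProd_eq (i := c) (b := i) (c := b) (d := d) (by simp [ne]), edge_comm c i,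
    edge_comm c b] at hc
  rw [starProd_eq (i := d) (b := i) (c := b) (d := c) (by simp [ne]), edge_comm d i,
    edge_comm d b, edge_comm d c] at hd
  rw [totalProd_eq_edge] at hp
  have eq : ∀ {r s t : k}, r * s = 1 → r * t = 1 → s = t := fun {r s t} h h' => by
    linear_combination t * h - s * h'
  have hcd : edge x c d = edge x i b :=
    eq (r := edge x i c * edge x i d) (by
      linear_combination hp - edge x i c * edge x i d * edge x c d * hb) (by rw [← hi]; ring)
  have hbd : edge x b d = edge x i c :=
    eq (r := edge x i b * edge x i d) (by
      linear_combination hp - edge x i b * edge x i d * edge x b d * hc) (by rw [← hi]; ring)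
  have hbc : edge x b c = edge x i d :=
    eq (r := edge x i b * edge x i c) (by
      linear_combination hp - edge x i b * edge x i c * edge x b c * hd) hi
  rw [hbc, hbd] at hb
  by_cases h₁ : edge x i b = 1
  · exact ⟨i, b, c, d, hn, .inr (.inl ⟨⟨h₁, hcd.trans h₁⟩, by rw [hbc, ← hi, h₁]; ring,
      by rw [hbd, ← hi, h₁]; ring⟩)⟩
  by_cases h₂ : edge x i c = 1
  · exact ⟨i, c, b, d, by simp [ne], .inr (.inl ⟨⟨h₂, hbd.trans h₂⟩,
      by rw [edge_comm c b, hbc, ← hi, h₂]; ring, by rw [hcd, ← hi, h₂]; ring⟩)⟩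
  by_cases h₃ : edge x i d = 1
  · exact ⟨i, d, b, c, by simp [ne], .inr (.inl ⟨⟨h₃, hbc.trans h₃⟩,
      by rw [edge_comm d b, hbd, ← hi, h₃]; ring, by rw [edge_comm d c, hcd, ← hi, h₃]; ring⟩)⟩
  exact ⟨i, b, c, d, hn, .inr (.inr ⟨⟨hcd, hbd, hbc⟩, ⟨h₁, h₂, h₃⟩, hi⟩)⟩

theorem exceptional_of_two_starProd_ne_one (hΓ : ∀ i j, i ≠ j → ¬ Gamma4 x i j)
    (hp : totalProd x i b c d = 1) (hn : [i, b, c, d].Nodup)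
    (hi : starProd x i ≠ 1) (hb : starProd x b ≠ 1) (hc : starProd x c = 1)
    (hd : starProd x d = 1) : Exceptional x := by
  have ne := ne_of_nodup hn
  have hcd := edge_eq_one_of_starProd_ne_one hΓ hp hn hi hb
  rw [starProd_eq (i := c) (b := i) (c := b) (d := d) (by simp [ne]), edge_comm c i,
    edge_comm c b, hcd, mul_one] at hc
  rw [starProd_eq (i := d) (b := i) (c := b) (d := c) (by simp [ne]), edge_comm d i,
    edge_comm d b, edge_comm d c, hcd, mul_one] at hd
  rw [totalProd_eq_edge, hcd] at hp
  refine ⟨i, b, c, d, hn, .inr (.inl ⟨⟨?_, hcd⟩, hc, hd⟩)⟩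
  linear_combination hp - edge x i b * edge x i d * edge x b d * hc - edge x i b * hd

/-- Each pair among `b, c, d` trivializes the opposite edge, so all edges at `i` are trivial. -/
theorem exceptional_of_three_starProd_ne_one (hΓ : ∀ i j, i ≠ j → ¬ Gamma4 x i j)
    (hp : totalProd x i b c d = 1) (hn : [i, b, c, d].Nodup)
    (hb : starProd x b ≠ 1) (hc : starProd x c ≠ 1)
    (hd : starProd x d ≠ 1) : Exceptional x := by
  have ne := ne_of_nodup hn
  have eid := edge_eq_one_of_starProd_ne_one hΓ (i := b) (b := c) (c := i) (d := d)
    (by rw [← prod_offDiag_eq (by simp [ne]), prod_offDiag_eq hn, hp]) (by simp [ne]) hb hc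
  have eic := edge_eq_one_of_starProd_ne_one hΓ (i := b) (b := d) (c := i) (d := c)
    (by rw [← prod_offDiag_eq (by simp [ne]), prod_offDiag_eq hn, hp]) (by simp [ne]) hb hd
  have eib := edge_eq_one_of_starProd_ne_one hΓ (i := c) (b := d) (c := i) (d := b)
    (by rw [← prod_offDiag_eq (by simp [ne]), prod_offDiag_eq hn, hp]) (by simp [ne]) hc hd
  rw [starProd_eq (i := b) (b := i) (c := c) (d := d) (by simp [ne]), edge_comm b i, eib,
    one_mul] at hb
  rw [starProd_eq (i := c) (b := i) (c := b) (d := d) (by simp [ne]), edge_comm c i,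
    edge_comm c b, eic, one_mul] at hc
  rw [starProd_eq (i := d) (b := i) (c := b) (d := c) (by simp [ne]), edge_comm d i,
    edge_comm d b, edge_comm d c, eid, one_mul] at hd
  rw [totalProd_eq_edge, eib, eic, eid, one_mul, one_mul, one_mul] at hp
  refine ⟨i, b, c, d, hn, .inl ⟨⟨eib, eic, eid⟩, ⟨fun h => hd ?_, fun h => hc ?_, fun h => hb ?_⟩,
    hp⟩⟩
  · rwa [h, one_mul] at hp
  · rwa [h, mul_one] at hp
  · rwa [h, mul_one] at hp

/-- Every edge lies in two stars, so the product of the four stars is the square of the total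
product. -/
theorem starProd_eq_one_of_others (hp : totalProd x i b c d = 1) (hn : [i, b, c, d].Nodup)
    (hb : starProd x b = 1) (hc : starProd x c = 1) (hd : starProd x d = 1) :
    starProd x i = 1 := by
  have ne := ne_of_nodup hn
  rw [starProd_eq (i := b) (b := i) (c := c) (d := d) (by simp [ne]), edge_comm b i] at hb
  rw [starProd_eq (i := c) (b := i) (c := b) (d := d) (by simp [ne]), edge_comm c i,
    edge_comm c b] at hc
  rw [starProd_eq (i := d) (b := i) (c := b) (d := c) (by simp [ne]), edge_comm d i,
    edge_comm d b, edge_comm d c] at hd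
  rw [starProd_eq hn]
  rw [totalProd_eq_edge] at hp
  have h : edge x i b * edge x b c * edge x b d * (edge x i c * edge x b c * edge x c d) *
      (edge x i d * edge x b d * edge x c d) = 1 := by rw [hb, hc, hd, one_mul, one_mul]
  linear_combination (edge x i b * edge x i c * edge x i d * edge x b c * edge x b d *
    edge x c d + 1) * hp - edge x i b * edge x i c * edge x i d * h

/-- Four nontrivial stars would trivialize every edge at `i`, hence the star at `i` itself. -/
theorem starProd_eq_one_of_others_ne_one (hΓ : ∀ i j, i ≠ j → ¬ Gamma4 x i j)
    (hp : totalProd x i b c d = 1) (hn : [i, b, c, d].Nodup)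
    (hi : starProd x i ≠ 1) (hb : starProd x b ≠ 1) (hc : starProd x c ≠ 1) : starProd x d = 1 := by
  by_contra hd
  have ne := ne_of_nodup hn
  have eid := edge_eq_one_of_starProd_ne_one hΓ (i := b) (b := c) (c := i) (d := d)
    (by rw [← prod_offDiag_eq (by simp [ne]), prod_offDiag_eq hn, hp]) (by simp [ne]) hb hc
  have eic := edge_eq_one_of_starProd_ne_one hΓ (i := b) (b := d) (c := i) (d := c)
    (by rw [← prod_offDiag_eq (by simp [ne]), prod_offDiag_eq hn, hp]) (by simp [ne]) hb hd
  have eib := edge_eq_one_of_starProd_ne_one hΓ (i := c) (b := d) (c := i) (d := b)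
    (by rw [← prod_offDiag_eq (by simp [ne]), prod_offDiag_eq hn, hp]) (by simp [ne]) hc hd
  rw [starProd_eq hn, eib, eic, eid] at hi
  simp at hi

theorem exceptional_of_not_gamma4 (hΓ : ∀ i j, i ≠ j → ¬ Gamma4 x i j)
    (hp : totalProd x 0 1 2 3 = 1) : Exceptional x := by
  have n : [(0 : Fin 4), 1, 2, 3].Nodup := by decide
  have p : ∀ {i b c d : Fin 4}, [i, b, c, d].Nodup → totalProd x i b c d = 1 := fun h => by
    rw [← prod_offDiag_eq h, prod_offDiag_eq n, hp]
  have one : ∀ {i b c d : Fin 4}, [i, b, c, d].Nodup → starProd x b = 1 → starProd x c = 1 →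
      starProd x d = 1 → starProd x i = 1 := fun h => starProd_eq_one_of_others (p h) h
  have two : ∀ {i b c d : Fin 4}, [i, b, c, d].Nodup → starProd x i ≠ 1 → starProd x b ≠ 1 →
      starProd x c = 1 → starProd x d = 1 → Exceptional x := fun h =>
    exceptional_of_two_starProd_ne_one hΓ (p h) h
  have three : ∀ {i b c d : Fin 4}, [i, b, c, d].Nodup → starProd x b ≠ 1 →
      starProd x c ≠ 1 → starProd x d ≠ 1 → Exceptional x := fun h =>
    exceptional_of_three_starProd_ne_one hΓ (p h) h
  by_cases h0 : starProd x 0 = 1 <;> by_cases h1 : starProd x 1 = 1 <;>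
    by_cases h2 : starProd x 2 = 1 <;> by_cases h3 : starProd x 3 = 1
  · exact exceptional_of_starProd_eq_one (p n) n h0 h1 h2 h3
  · exact absurd (one (i := 3) (b := 0) (c := 1) (d := 2) (by decide) h0 h1 h2) h3
  · exact absurd (one (i := 2) (b := 0) (c := 1) (d := 3) (by decide) h0 h1 h3) h2
  · exact two (i := 2) (b := 3) (c := 0) (d := 1) (by decide) h2 h3 h0 h1
  · exact absurd (one (i := 1) (b := 0) (c := 2) (d := 3) (by decide) h0 h2 h3) h1
  · exact two (i := 1) (b := 3) (c := 0) (d := 2) (by decide) h1 h3 h0 h2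
  · exact two (i := 1) (b := 2) (c := 0) (d := 3) (by decide) h1 h2 h0 h3
  · exact three (i := 0) (b := 1) (c := 2) (d := 3) (by decide) h1 h2 h3
  · exact absurd (one (i := 0) (b := 1) (c := 2) (d := 3) (by decide) h1 h2 h3) h0
  · exact two (i := 0) (b := 3) (c := 1) (d := 2) (by decide) h0 h3 h1 h2
  · exact two (i := 0) (b := 2) (c := 1) (d := 3) (by decide) h0 h2 h1 h3
  · exact three (i := 1) (b := 0) (c := 2) (d := 3) (by decide) h0 h2 h3
  · exact two (i := 0) (b := 1) (c := 2) (d := 3) (by decide) h0 h1 h2 h3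
  · exact three (i := 2) (b := 0) (c := 1) (d := 3) (by decide) h0 h1 h3
  · exact three (i := 3) (b := 0) (c := 1) (d := 2) (by decide) h0 h1 h2
  · exact absurd (starProd_eq_one_of_others_ne_one hΓ (p n) n h0 h1 h2) h3

theorem Exceptional.exists_operation (h : Exceptional x)
    (hp : ∏ e ∈ (Finset.univ : Finset (Fin 4)).offDiag, (x e.1).p (x e.2) = 1) :
    ∃ W, W ≠ 0 ∧ IsMultilinearOperation x W := by
  obtain ⟨i, b, c, d, hn, h | h | h⟩ := h <;> rw [prod_offDiag_eq hn] at hp <;>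
    exact h.exists_operation hp hn

theorem Exceptional.mem_span (h : Exceptional x) {W : FreeAlgebra k (Fin 4)}
    (hW : IsMultilinearOperation x W) :
    W ∈ Submodule.span k (multilinearSuperpositions x) := by
  obtain ⟨i, b, c, d, hn, h⟩ := h
  obtain ⟨β, rfl, hβ, -⟩ := hW.exists_commSum hn
  rcases h with h | h | h <;> exact h.mem_span hn hβ

theorem exists_nodup_of_ne : ∀ i j : Fin 4, i ≠ j → ∃ l s, [i, j, l, s].Nodup := by
  decide

theorem exists_basis_of_gamma4
    (hp : ∏ e ∈ (Finset.univ : Finset (Fin 4)).offDiag, (x e.1).p (x e.2) = 1)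
    (hΓ : ∃ i j, i ≠ j ∧ Gamma4 x i j) :
    ∃ W₁ W₂ : FreeAlgebra k (Fin 4), LinearIndependent k ![W₁, W₂] ∧
        ∀ W, IsMultilinearOperation x W ↔ ∃ a b : k, W = a • W₁ + b • W₂ := by
  obtain ⟨i, j, hij, h⟩ := hΓ
  obtain ⟨l, s, hn⟩ := exists_nodup_of_ne i j hij
  exact ((gamma4_iff hn).mp h).exists_basis (by rw [← prod_offDiag_eq hn, hp]) hn

end Classification

theorem theorem8p4 {k : Type u} {G : Type v} [Field k] [CommGroup G]
    (x : Fin 4 → QuantumVariable k G) :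
    ((∃ W, W ≠ 0 ∧ IsMultilinearOperation x W) ↔
      ∏ e ∈ (Finset.univ : Finset (Fin 4)).offDiag, (x e.1).p (x e.2) = 1) ∧
    (∏ e ∈ (Finset.univ : Finset (Fin 4)).offDiag, (x e.1).p (x e.2) = 1 →
      (∃ i j, i ≠ j ∧ Gamma4 x i j) →
      ∃ W₁ W₂ : FreeAlgebra k (Fin 4), LinearIndependent k ![W₁, W₂] ∧
        ∀ W, IsMultilinearOperation x W ↔ ∃ a b : k, W = a • W₁ + b • W₂) ∧
    ((∀ i j, i ≠ j → ¬ Gamma4 x i j) →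
      ∀ W, IsMultilinearOperation x W →
        W ∈ Submodule.span k (multilinearSuperpositions x)) := by
  have n : [(0 : Fin 4), 1, 2, 3].Nodup := by decide
  have total : ∀ W, IsMultilinearOperation x W → W ≠ 0 →
      ∏ e ∈ (Finset.univ : Finset (Fin 4)).offDiag, (x e.1).p (x e.2) = 1 := fun W hW h0 => by
    obtain ⟨-, -, -, h⟩ := hW.exists_commSum n
    rw [prod_offDiag_eq n]
    exact h.resolve_right h0
  refine ⟨⟨fun ⟨W, h0, hW⟩ => total W hW h0, fun hp => ?_⟩, exists_basis_of_gamma4,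
    fun hΓ W hW => ?_⟩
  · by_cases hΓ : ∃ i j, i ≠ j ∧ Gamma4 x i j
    · obtain ⟨W₁, W₂, hli, h⟩ := exists_basis_of_gamma4 hp hΓ
      exact ⟨W₁, hli.ne_zero 0, (h W₁).mpr ⟨1, 0, by simp⟩⟩
    · refine (exceptional_of_not_gamma4 (fun i j hij h => hΓ ⟨i, j, hij, h⟩) ?_).exists_operation hp
      rw [← prod_offDiag_eq n, hp]
  -- The third claim does not assume that the total product is 1; a nonzero operation supplies it.
  · rcases eq_or_ne W 0 with rfl | h0
    · exact zero_mem _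
    · refine (exceptional_of_not_gamma4 hΓ ?_).mem_span hW
      rw [← prod_offDiag_eq n, total W hW h0]
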